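/- Let $G$ be a connected finite simple graph with adjacency matrix $A(G)$. For a real number $\lambda$ let $m_\lambda(G)$ be the multiplicity of $\lambda$ as an eigenvalue of $A(G)$. Let $\beta'(G)$ be the induced matching number of $G$, that is, the maximum number of edges in a matching $M$ of $G$ such that no edge of $G$ joins end vertices of distinct edges of $M$. Let $c(G)=|E(G)|-|V(G)|+\omega(G)$ be the cyclomatic number, where $\omega(G)$ is the number of connected components of $G$. For an integer $a\ge 0$ let $C_3(a,a,a)$ be the graph obtained from a triangle $C_3$ by attaching $a$ pendant vertices to each of its vertices, and let $C_5$ be the cycle on five vertices. (1) For every eigenvalue $\lambda\neq 0$ of $A(G)$, $$m_\lambda(G)\le \beta'(G)+c(G),$$ and equality holds for this $\lambda$ if and only if one of the following holds: (i) $G\cong C_3(a,a,a)$ for some integer $a\ge 0$, and $\lambda=\frac{\sqrt{1+4a}-1}{2}$ or $\lambda=-\frac{\sqrt{1+4a}+1}{2}$; (ii) $G\cong C_5$, and $\lambda=\frac{\sqrt5-1}{2}$ or $\lambda=-\frac{\sqrt5+1}{2}$; (iii) $G$ is a tree of diameter $1$, $2$ or $3$. (2) Consequently, equality $m_\lambda(G)=\beta'(G)+c(G)$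 is attained by some eigenvalue $\lambda\ne 0$ of $A(G)$ if and only if $G\cong C_3(a,a,a)$ for some integer $a\geq 0$, or $G\cong C_5$, or $G$ is a tree of diameter $1$, $2$ or $3$. -/

import Mathlib

namespace InducedMatchingBound

open SimpleGraph

/-- The multiplicity `m_t(G)` of the real number `t` as an eigenvalue of the adjacency matrix of
`G`: the dimension of the eigenspace `{x | A(G) x = t x}` (it is `0` if `t` is not an eigenvalue).
Since `A(G)` is real symmetric, algebraic and geometric multiplicities agree. -/
noncomputable def eigMult {V : Type*} [Fintype V] [DecidableEq V] (G : SimpleGraph V)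
    [DecidableRel G.Adj] (t : ℝ) : ℕ :=
  Module.finrank ℝ (Module.End.eigenspace (Matrix.toLin' (G.adjMatrix ℝ)) t)

/-- `M` is an induced matching of `G`: a set of edges of `G` such that distinct edges of `M` have
no common end, and no edge of `G` joins ends of distinct edges of `M`. -/
def IsInducedMatching {V : Type*} (G : SimpleGraph V) (M : Finset (Sym2 V)) : Prop :=
  (∀ e ∈ M, e ∈ G.edgeSet) ∧
    ∀ e ∈ M, ∀ f ∈ M, e ≠ f → ∀ u ∈ e, ∀ v ∈ f, u ≠ v ∧ ¬ G.Adj u v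

/-- The induced matching number `β'(G)`: the largest number of edges of an induced matching.
For a finite vertex set the set below is nonempty and bounded, so the supremum is a maximum. -/
noncomputable def inducedMatchingNumber {V : Type*} (G : SimpleGraph V) : ℕ :=
  sSup {k : ℕ | ∃ M : Finset (Sym2 V), IsInducedMatching G M ∧ M.card = k}

/-- The cyclomatic number `c(G) = |E(G)| - |V(G)| + ω(G)`, where `ω(G)` is the number of connected
components, for a finite graph `G`. -/
noncomputable def cyclomaticNumber {V : Type*} (G : SimpleGraph V) : ℤ :=
  (Nat.card G.edgeSet : ℤ) - (Nat.card V : ℤ) + (Nat.card G.ConnectedComponent : ℤ)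

/-- The graph `C_3(a,a,a)`: a triangle on the vertices `inl i`, with `a` pendant vertices
`inr (i, j)` attached to each vertex `inl i` of the triangle. -/
def triangleWithPendants (a : ℕ) : SimpleGraph (Fin 3 ⊕ Fin 3 × Fin a) where
  Adj
    | .inl i, .inl j => i ≠ j
    | .inl i, .inr p => i = p.1
    | .inr p, .inl i => i = p.1
    | .inr _, .inr _ => False
  symm := ⟨by
    rintro (i | p) (j | q) h
    · exact Ne.symm h
    · exact h
    · exact h
    · exact h⟩
  loopless := ⟨by
    rintro (i | p) h
    · exact h rfl
    · exact h⟩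

end InducedMatchingBound

/-!
Write `m`, `β'`, `c` for the multiplicity of a fixed `t ≠ 0`, the induced matching number and the
cyclomatic number. All graphs in the induction live on one vertex set: a vertex is removed by
deleting its edges (`isolate`), and since `t ≠ 0` the remaining isolated vertices carry no
eigenvector.

*The bound.* Requiring an eigenvector to vanish at one vertex costs at most one dimension
(`finrank_le_add_one_of_apply`). If `x` lies on a cycle, then removing `x` lowers `m` by at most one
and `c` by at least one, and does not raise `β'` (`multLe_of_isolate_cyclic`). A forest with an edge
has a vertex `v` with a pendant neighbour and at most one non-pendant neighbour
(`exists_almost_pendant`); an eigenvector that vanishes at `v` vanishes on its closed neighbourhood,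
whose removal lowers `β'` by at least one (`multLe_of_isolate_star`).

*Equality.* If equality holds, all these estimates are sharp, so every eigenvector of the smaller
graph extends by zero to `H`. The induction therefore also gives that every non-isolated vertex is
in the support of some eigenvector (`FullSupport`). This forbids a nontrivial component attached to
the removed part by a single edge: restrict to that component an eigenvector that is nonzero at the
attaching vertex, and the eigenvalue equation at the other end of the edge fails. Hence a connected
forest with equality is a star or a double star (`exists_double_star`), and a vertex `x` on a cycle
has exactly two non-pendant neighbours `p`, `q`, with `y p + y q = 0` for all eigenvectors `y` of
`H - x` (`cyclicSplit`).

By induction any two non-isolated vertices of a connected graph with equality are joined by a walk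
of length at most three (`diamLeThree`). Applied to `H - x`, this puts `x` on a cycle of length
three, four or five all of whose vertices have only pendant further neighbours. The eigenvalue
equations give `t² + t` pendant vertices at each vertex of a triangle (`isTriangleCore`), exclude
the four-cycle (`not_square`), and give `t² + t = 1` on a five-cycle
(`IsPentagonComponent.eigenvalue_eq`), where the bound on walks excludes pendant vertices
(`nbr_of_pentagon`).

Conversely, `β' ≤ 1` and `c ≤ 1` for the exceptional graphs, which have two explicit independent
eigenvectors, while `β' ≤ 1` and `c = 0` for trees of diameter at most three.
-/

namespace InducedMatchingBound

open SimpleGraph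

variable {V : Type*}

/-! ### Deleting the edges at a set of vertices -/

/-- The graph `H` with all edges that meet `S` deleted. It replaces the vertex-deleted graph `H - S`:
the vertices of `S` stay as isolated vertices, which changes neither the eigenspaces of nonzero
eigenvalues, nor the induced matching number, nor the cyclomatic number. -/
def isolate (H : SimpleGraph V) (S : Set V) : SimpleGraph V where
  Adj a b := H.Adj a b ∧ a ∉ S ∧ b ∉ S
  symm := ⟨fun _ _ h => ⟨h.1.symm, h.2.2, h.2.1⟩⟩
  loopless := ⟨fun a h => H.loopless.irrefl a h.1⟩

theorem isolate_adj {H : SimpleGraph V} {S : Set V} {a b : V} :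
    (isolate H S).Adj a b ↔ H.Adj a b ∧ a ∉ S ∧ b ∉ S := Iff.rfl

theorem isolate_le (H : SimpleGraph V) (S : Set V) : isolate H S ≤ H := fun _ _ h => h.1

theorem isolate_anti (H : SimpleGraph V) {S T : Set V} (h : S ⊆ T) :
    isolate H T ≤ isolate H S :=
  fun _ _ hab => ⟨hab.1, fun ha => hab.2.1 (h ha), fun hb => hab.2.2 (h hb)⟩

theorem isolate_mono {H K : SimpleGraph V} (h : K ≤ H) (S : Set V) :
    isolate K S ≤ isolate H S :=
  fun _ _ hab => ⟨h hab.1, hab.2⟩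

/-- A vertex `x` is cyclic if two of its neighbours stay connected after `x` is removed, that is,
if `x` lies on a cycle. -/
def IsCyclicVertex (H : SimpleGraph V) (x : V) : Prop :=
  ∃ p q, p ≠ q ∧ H.Adj x p ∧ H.Adj x q ∧ (isolate H {x}).Reachable p q

/-- Every neighbour of `u` is `v`; for `u` adjacent to `v` this says that `u` is a pendant vertex
attached to `v`. -/
def OnlyNeighbor (H : SimpleGraph V) (u v : V) : Prop := ∀ a, H.Adj u a → a = v

theorem exists_adj_of_reachable_ne {H : SimpleGraph V} {a b : V} (h : H.Reachable a b)
    (hab : a ≠ b) : ∃ c, H.Adj a c := by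
  obtain ⟨w⟩ := h
  cases w with
  | nil => exact absurd rfl hab
  | cons h _ => exact ⟨_, h⟩

/-! ### The cyclomatic number under edge deletion -/

section Cyclomatic

theorem cyclomaticNumber_bot : cyclomaticNumber (⊥ : SimpleGraph V) = 0 := by
  have h : Nat.card (⊥ : SimpleGraph V).ConnectedComponent = Nat.card V := by
    refine (Nat.card_congr (Equiv.ofBijective (⊥ : SimpleGraph V).connectedComponentMk
      ⟨fun a b hab => ?_, fun C => ?_⟩)).symm
    · simpa using hab
    · induction C using ConnectedComponent.ind with | _ a
      exact ⟨a, rfl⟩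
  unfold cyclomaticNumber
  rw [h]
  simp

variable [Finite V]

theorem edgeSet_ncard_deleteEdges {H : SimpleGraph V} {x q : V} (h : H.Adj x q) :
    Nat.card (H.deleteEdges {s(x, q)}).edgeSet + 1 = Nat.card H.edgeSet := by
  have h1 : s(x, q) ∈ H.edgeSet := h
  rw [edgeSet_deleteEdges, Nat.card_coe_set_eq, Nat.card_coe_set_eq]
  exact Set.ncard_sdiff_singleton_add_one h1 (Set.toFinite _)

theorem cyclomaticNumber_deleteEdges_le {H : SimpleGraph V} {x q : V} (h : H.Adj x q) :
    cyclomaticNumber (H.deleteEdges {s(x, q)}) ≤ cyclomaticNumber H := by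
  classical
  have h1 := edgeSet_ncard_deleteEdges h
  have h2 : Nat.card (H.deleteEdges {s(x, q)}).ConnectedComponent ≤
      Nat.card H.ConnectedComponent + 1 := by
    set H' := H.deleteEdges {s(x, q)} with hH'
    have hle : H' ≤ H := deleteEdges_le _
    let f : H'.ConnectedComponent → Option H.ConnectedComponent := fun C =>
      if C = H'.connectedComponentMk x then none
      else some (C.map (Hom.ofLE hle))
    have aux : ∀ a b : V, H.Reachable a b → H'.Reachable a b ∨
        ((H'.Reachable x a ∨ H'.Reachable q a) ∧ (H'.Reachable x b ∨ H'.Reachable q b)) := by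
      intro a b hab
      obtain ⟨w⟩ := hab
      induction w with
      | nil => exact Or.inl (Reachable.refl _)
      | @cons a c b hac w ih =>
        by_cases he : s(a, c) = s(x, q)
        · right
          rcases Sym2.eq_iff.1 he with ⟨rfl, rfl⟩ | ⟨rfl, rfl⟩
          · exact ⟨Or.inl (Reachable.refl _), ih.elim Or.inr And.right⟩
          · exact ⟨Or.inr (Reachable.refl _), ih.elim Or.inl And.right⟩
        · have hac' : H'.Adj a c := by
            rw [hH', deleteEdges_adj]; exact ⟨hac, he⟩
          rcases ih with ih | ⟨h1, h2⟩
          · exact Or.inl (hac'.reachable.trans ih)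
          · exact Or.inr ⟨h1.imp (·.trans hac'.symm.reachable)
              (·.trans hac'.symm.reachable), h2⟩
    have key : ∀ a b : V, H.Reachable a b → H'.Reachable a b ∨ H'.Reachable x a ∨
        H'.Reachable x b := by
      intro a b hab
      rcases aux a b hab with h | ⟨h1 | h1, h2⟩
      · exact Or.inl h
      · exact Or.inr (Or.inl h1)
      · rcases h2 with h2 | h2
        · exact Or.inr (Or.inr h2)
        · exact Or.inl (h1.symm.trans h2)
    have hf : Function.Injective f := by
      intro C D hCD
      induction C using ConnectedComponent.ind with | _ a
      induction D using ConnectedComponent.ind with | _ b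
      by_cases ha : H'.connectedComponentMk a = H'.connectedComponentMk x <;>
      by_cases hb : H'.connectedComponentMk b = H'.connectedComponentMk x
      · rw [ha, hb]
      · simp [f, ha, hb] at hCD
      · simp [f, ha, hb] at hCD
      · simp only [f, ha, hb, if_false, Option.some.injEq, ConnectedComponent.map_mk,
          ConnectedComponent.eq] at hCD
        rw [ConnectedComponent.eq] at ha hb ⊢
        rcases key a b hCD with h | h | h
        · exact h
        · exact absurd h.symm ha
        · exact absurd h.symm hb
    have := Nat.card_le_card_of_injective f hf
    rwa [Finite.card_option] at this
  unfold cyclomaticNumber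
  omega

theorem cyclomaticNumber_deleteEdges_of_reachable {H : SimpleGraph V} {x q : V} (h : H.Adj x q)
    (hr : (H.deleteEdges {s(x, q)}).Reachable x q) :
    cyclomaticNumber (H.deleteEdges {s(x, q)}) + 1 ≤ cyclomaticNumber H := by
  have h1 := edgeSet_ncard_deleteEdges h
  have h2 : Nat.card (H.deleteEdges {s(x, q)}).ConnectedComponent ≤
      Nat.card H.ConnectedComponent := by
    set H' := H.deleteEdges {s(x, q)} with hH'
    have key : ∀ a b : V, H.Reachable a b → H'.Reachable a b := by
      intro a b hab
      obtain ⟨w⟩ := hab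
      induction w with
      | nil => exact Reachable.refl _
      | @cons a c b hac w ih =>
        refine Reachable.trans ?_ ih
        by_cases he : s(a, c) = s(x, q)
        · rcases Sym2.eq_iff.1 he with ⟨rfl, rfl⟩ | ⟨rfl, rfl⟩
          · exact hr
          · exact hr.symm
        · have hac' : H'.Adj a c := by
            rw [hH', deleteEdges_adj]; exact ⟨hac, he⟩
          exact hac'.reachable
    have hle : H' ≤ H := deleteEdges_le _
    refine Nat.card_le_card_of_injective (fun C => C.map (Hom.ofLE hle)) ?_
    intro C D hCD
    induction C using ConnectedComponent.ind with | _ a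
    induction D using ConnectedComponent.ind with | _ b
    simp only [ConnectedComponent.map_mk, ConnectedComponent.eq] at hCD
    exact ConnectedComponent.eq.2 (key a b hCD)
  unfold cyclomaticNumber
  omega

theorem cyclomaticNumber_mono {H' H : SimpleGraph V} (hle : H' ≤ H) :
    cyclomaticNumber H' ≤ cyclomaticNumber H := by
  induction hn : Nat.card H.edgeSet generalizing H with
  | zero =>
    have : H' = H := by
      refine le_antisymm hle fun a b hab => ?_
      have := edgeSet_ncard_deleteEdges hab
      omega
    rw [this]
  | succ n ih =>
    by_cases hall : ∀ a b, H.Adj a b → H'.Adj a b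
    · rw [le_antisymm hle fun a b => hall a b]
    · push Not at hall
      obtain ⟨a, b, hab, hab'⟩ := hall
      refine (ih (H := H.deleteEdges {s(a, b)}) ?_ ?_).trans
        (cyclomaticNumber_deleteEdges_le hab)
      · intro c d hcd
        rw [deleteEdges_adj]
        refine ⟨hle hcd, fun he => hab' ?_⟩
        rcases Sym2.eq_iff.1 (Set.mem_singleton_iff.1 he) with ⟨rfl, rfl⟩ | ⟨rfl, rfl⟩
        · exact hcd
        · exact hcd.symm
      · have := edgeSet_ncard_deleteEdges hab
        omega

/-- Isolating a vertex with two neighbours that stay connected lowers the cyclomatic number. -/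
theorem cyclomaticNumber_isolate_add_one_le {H : SimpleGraph V} {x p q : V} (hpq : p ≠ q)
    (hp : H.Adj x p) (hq : H.Adj x q) (hr : (isolate H {x}).Reachable p q) :
    cyclomaticNumber (isolate H {x}) + 1 ≤ cyclomaticNumber H := by
  have hle : isolate H {x} ≤ H.deleteEdges {s(x, q)} := by
    intro a b hab
    rw [deleteEdges_adj]
    refine ⟨hab.1, fun he => ?_⟩
    rcases Sym2.eq_iff.1 (Set.mem_singleton_iff.1 he) with ⟨rfl, rfl⟩ | ⟨rfl, rfl⟩
    · exact hab.2.1 rfl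
    · exact hab.2.2 rfl
  have hp' : (H.deleteEdges {s(x, q)}).Adj x p := by
    rw [deleteEdges_adj]
    refine ⟨hp, fun he => ?_⟩
    rcases Sym2.eq_iff.1 (Set.mem_singleton_iff.1 he) with ⟨_, h⟩ | ⟨h, _⟩
    · exact hpq h
    · exact hq.ne h
  have h1 := cyclomaticNumber_deleteEdges_of_reachable hq
    (hp'.reachable.trans (hr.mono hle))
  have h2 := cyclomaticNumber_mono hle
  omega

/-- Isolating `x` lowers the cyclomatic number by at least two if two different neighbours `q`, `s`
of `x` stay connected to neighbours outside `{q, s}`. -/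
theorem cyclomaticNumber_isolate_add_two_le {H : SimpleGraph V} {x p q r s : V} (hqs : q ≠ s)
    (hpq : p ≠ q) (hrq : r ≠ q) (hrs : r ≠ s)
    (hp : H.Adj x p) (hq : H.Adj x q) (hr : H.Adj x r) (hs : H.Adj x s)
    (h1 : (isolate H {x}).Reachable p q) (h2 : (isolate H {x}).Reachable r s) :
    cyclomaticNumber (isolate H {x}) + 2 ≤ cyclomaticNumber H := by
  have hdel : ∀ {a y : V}, H.Adj x y → y ≠ a → (H.deleteEdges {s(x, a)}).Adj x y := by
    intro a y hy hya
    rw [deleteEdges_adj]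
    refine ⟨hy, fun he => ?_⟩
    rcases Sym2.eq_iff.1 (Set.mem_singleton_iff.1 he) with ⟨_, h⟩ | ⟨_, h⟩
    · exact hya h
    · exact hy.ne h.symm
  have hle : isolate H {x} ≤ H.deleteEdges {s(x, q)} := by
    intro a b hab
    rw [deleteEdges_adj]
    refine ⟨hab.1, fun he => ?_⟩
    rcases Sym2.eq_iff.1 (Set.mem_singleton_iff.1 he) with ⟨rfl, rfl⟩ | ⟨rfl, rfl⟩
    · exact hab.2.1 rfl
    · exact hab.2.2 rfl
  have hiso : isolate H {x} ≤ isolate (H.deleteEdges {s(x, q)}) {x} :=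
    fun a b hab => ⟨hle hab, hab.2⟩
  have h3 := cyclomaticNumber_deleteEdges_of_reachable hq
    ((hdel hp hpq).reachable.trans (h1.mono hle))
  have h4 := cyclomaticNumber_isolate_add_one_le (H := H.deleteEdges {s(x, q)}) hrs (hdel hr hrq)
    (hdel hs hqs.symm) (h2.mono hiso)
  have h5 := cyclomaticNumber_mono hiso
  omega

end Cyclomatic

/-! ### The induced matching number under vertex deletion -/

section Matching

theorem IsInducedMatching.of_isolate {H : SimpleGraph V} {S : Set V} {M : Finset (Sym2 V)}
    (hM : IsInducedMatching (isolate H S) M) :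
    IsInducedMatching H M ∧ ∀ e ∈ M, ∀ u ∈ e, u ∉ S := by
  have hS : ∀ e ∈ M, ∀ u ∈ e, u ∉ S := by
    intro e he u hu
    have h := hM.1 e he
    induction e using Sym2.ind with | _ a b
    have h' : (isolate H S).Adj a b := h
    rcases Sym2.mem_iff.1 hu with rfl | rfl
    · exact h'.2.1
    · exact h'.2.2
  refine ⟨⟨fun e he => edgeSet_mono (isolate_le H S) (hM.1 e he), ?_⟩, hS⟩
  intro e he f hf hef u hu v hv
  obtain ⟨h1, h2⟩ := hM.2 e he f hf hef u hu v hv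
  exact ⟨h1, fun h => h2 ⟨h, hS e he u hu, hS f hf v hv⟩⟩

variable [Finite V]

theorem bddAbove_inducedMatching (H : SimpleGraph V) :
    BddAbove {k : ℕ | ∃ M : Finset (Sym2 V), IsInducedMatching H M ∧ M.card = k} := by
  classical
  have := Fintype.ofFinite V
  refine ⟨Fintype.card (Sym2 V), ?_⟩
  rintro k ⟨M, -, rfl⟩
  exact M.card_le_univ

theorem card_le_inducedMatchingNumber {H : SimpleGraph V} {M : Finset (Sym2 V)}
    (hM : IsInducedMatching H M) : M.card ≤ inducedMatchingNumber H :=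
  le_csSup (bddAbove_inducedMatching H) ⟨M, hM, rfl⟩

theorem exists_card_eq_inducedMatchingNumber (H : SimpleGraph V) :
    ∃ M : Finset (Sym2 V), IsInducedMatching H M ∧ M.card = inducedMatchingNumber H :=
  Nat.sSup_mem (s := {k : ℕ | ∃ M : Finset (Sym2 V), IsInducedMatching H M ∧ M.card = k})
    ⟨0, ∅, ⟨by simp, by simp⟩, rfl⟩ (bddAbove_inducedMatching H)

theorem inducedMatchingNumber_isolate_le (H : SimpleGraph V) (S : Set V) :
    inducedMatchingNumber (isolate H S) ≤ inducedMatchingNumber H := by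
  obtain ⟨M, hM, hc⟩ := exists_card_eq_inducedMatchingNumber (isolate H S)
  rw [← hc]
  exact card_le_inducedMatchingNumber hM.of_isolate.1

/-- If `u` is a pendant vertex at `v`, the edge `uv` extends every induced matching that avoids the
closed neighbourhood of `v`. -/
theorem inducedMatchingNumber_isolate_add_one_le {H : SimpleGraph V} {u v : V} (huv : H.Adj v u)
    (hu : OnlyNeighbor H u v) :
    inducedMatchingNumber (isolate H {z | z = v ∨ H.Adj v z}) + 1 ≤ inducedMatchingNumber H := by
  classical
  obtain ⟨M, hM, hc⟩ := exists_card_eq_inducedMatchingNumber (isolate H {z | z = v ∨ H.Adj v z})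
  obtain ⟨hM1, hS⟩ := hM.of_isolate
  have hvu : ∀ e ∈ M, ∀ a ∈ e, a ≠ v ∧ a ≠ u ∧ ¬ H.Adj v a ∧ ¬ H.Adj u a := by
    intro e he a ha
    have := hS e he a ha
    simp only [Set.mem_ofPred_eq, not_or] at this
    refine ⟨this.1, ?_, this.2, fun h => this.1 (hu a h)⟩
    rintro rfl
    exact this.2 huv
  have hnot : s(v, u) ∉ M := fun h => (hvu _ h v (Sym2.mem_mk_left _ _)).1 rfl
  rw [← hc, ← Finset.card_insert_of_notMem hnot]
  refine card_le_inducedMatchingNumber ⟨?_, ?_⟩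
  · intro e he
    rcases Finset.mem_insert.1 he with rfl | he
    · exact huv
    · exact hM1.1 e he
  · intro e he f hf hef a ha b hb
    rcases Finset.mem_insert.1 he with rfl | he <;> rcases Finset.mem_insert.1 hf with rfl | hf
    · exact absurd rfl hef
    · obtain ⟨h1, h2, h3, h4⟩ := hvu f hf b hb
      rcases Sym2.mem_iff.1 ha with rfl | rfl
      · exact ⟨h1.symm, h3⟩
      · exact ⟨h2.symm, h4⟩
    · obtain ⟨h1, h2, h3, h4⟩ := hvu e he a ha
      rcases Sym2.mem_iff.1 hb with rfl | rfl
      · exact ⟨h1, fun h => h3 h.symm⟩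
      · exact ⟨h2, fun h => h4 h.symm⟩
    · exact hM1.2 e he f hf hef a ha b hb

theorem inducedMatchingNumber_le_one {H : SimpleGraph V}
    (h : ∀ a b c d, H.Adj a b → H.Adj c d → a ≠ c → a ≠ d → b ≠ c → b ≠ d →
      H.Adj a c ∨ H.Adj a d ∨ H.Adj b c ∨ H.Adj b d) : inducedMatchingNumber H ≤ 1 := by
  obtain ⟨M, hM, hc⟩ := exists_card_eq_inducedMatchingNumber H
  rw [← hc, Finset.card_le_one]
  intro e he f hf
  by_contra hef
  have h1 := hM.2 e he f hf hef
  have he' := hM.1 e he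
  have hf' := hM.1 f hf
  induction e using Sym2.ind with | _ a b
  induction f using Sym2.ind with | _ c d
  have hac := h1 a (by simp) c (by simp)
  have had := h1 a (by simp) d (by simp)
  have hbc := h1 b (by simp) c (by simp)
  have hbd := h1 b (by simp) d (by simp)
  rcases h a b c d he' hf' hac.1 had.1 hbc.1 hbd.1 with h | h | h | h
  · exact hac.2 h
  · exact had.2 h
  · exact hbc.2 h
  · exact hbd.2 h

end Matching

/-! ### Eigenspaces -/

section Eigenspace

variable [Fintype V]

open Classical in
/-- The space of all `y : V → ℝ` with `A(H) y = t y`. -/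
noncomputable def eigSpace (H : SimpleGraph V) (t : ℝ) : Submodule ℝ (V → ℝ) where
  carrier := {y | ∀ v, ∑ w, (if H.Adj v w then y w else 0) = t * y v}
  add_mem' := by
    intro y z hy hz v
    have h : ∀ w, (if H.Adj v w then (y + z) w else 0) =
        (if H.Adj v w then y w else 0) + (if H.Adj v w then z w else 0) := by
      intro w; split_ifs <;> simp
    rw [Finset.sum_congr rfl fun w _ => h w, Finset.sum_add_distrib, hy v, hz v, Pi.add_apply,
      mul_add]
  zero_mem' := by intro v; simp
  smul_mem' := by
    intro c y hy v
    have h : ∀ w, (if H.Adj v w then (c • y) w else 0) =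
        c * (if H.Adj v w then y w else 0) := by
      intro w; split_ifs <;> simp
    rw [Finset.sum_congr rfl fun w _ => h w, ← Finset.mul_sum, hy v, Pi.smul_apply, smul_eq_mul]
    ring

variable {H : SimpleGraph V} {t : ℝ}

open Classical in
theorem mem_eigSpace {y : V → ℝ} :
    y ∈ eigSpace H t ↔ ∀ v, ∑ w, (if H.Adj v w then y w else 0) = t * y v := Iff.rfl

theorem eigenspace_eq_eigSpace [DecidableEq V] [DecidableRel H.Adj] :
    Module.End.eigenspace (Matrix.toLin' (H.adjMatrix ℝ)) t = eigSpace H t := by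
  ext y
  rw [Module.End.mem_eigenspace_iff, mem_eigSpace, funext_iff]
  refine forall_congr' fun v => ?_
  have : (Matrix.toLin' (H.adjMatrix ℝ)) y v = ∑ w, (if H.Adj v w then y w else 0) := by
    simp [Matrix.toLin'_apply, Matrix.mulVec, dotProduct, adjMatrix_apply]
  rw [this, Pi.smul_apply, smul_eq_mul]
  have h2 : ∀ w, (@ite ℝ (H.Adj v w) (Classical.propDecidable _) (y w) 0) =
      if H.Adj v w then y w else 0 := fun w => by congr
  simp only [h2]

theorem eigMult_eq_finrank [DecidableEq V] [DecidableRel H.Adj] :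
    eigMult H t = Module.finrank ℝ (eigSpace H t) := by
  rw [eigMult, eigenspace_eq_eigSpace]

theorem eigSpace_apply_eq_zero (ht : t ≠ 0) {y : V → ℝ} (hy : y ∈ eigSpace H t) {v : V}
    (hv : ∀ w, ¬ H.Adj v w) : y v = 0 := by
  have h := mem_eigSpace.1 hy v
  simp only [hv, if_false, Finset.sum_const_zero] at h
  exact (mul_eq_zero.1 h.symm).resolve_left ht

theorem eigSpace_apply_pendant {y : V → ℝ} (hy : y ∈ eigSpace H t) {u v : V}
    (huv : H.Adj u v) (hu : OnlyNeighbor H u v) : t * y u = y v := by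
  classical
  rw [← mem_eigSpace.1 hy u, Finset.sum_eq_single v]
  · simp [huv]
  · intro b _ hb
    exact if_neg fun h => hb (hu b h)
  · simp

theorem eigSpace_bot (ht : t ≠ 0) : eigSpace (⊥ : SimpleGraph V) t = ⊥ := by
  rw [eq_bot_iff]
  intro y hy
  rw [Submodule.mem_bot]
  funext v
  exact eigSpace_apply_eq_zero ht hy (fun w h => h)

/-- An eigenvector that vanishes on `S` stays one when the edges at `S` are deleted. -/
theorem mem_eigSpace_isolate {S : Set V} {y : V → ℝ} (hy : y ∈ eigSpace H t)
    (hS : ∀ v ∈ S, y v = 0) : y ∈ eigSpace (isolate H S) t := by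
  classical
  rw [mem_eigSpace]
  intro v
  by_cases hv : v ∈ S
  · rw [hS v hv, mul_zero]
    exact Finset.sum_eq_zero fun w _ => if_neg fun h => h.2.1 hv
  · rw [← mem_eigSpace.1 hy v]
    refine Finset.sum_congr rfl fun w _ => ?_
    by_cases hw : w ∈ S
    · simp [hS w hw]
    · simp [isolate_adj, hv, hw]

open Classical in
/-- The restriction of an eigenvector to a connected component is an eigenvector. -/
theorem component_mem_eigSpace {y : V → ℝ} (hy : y ∈ eigSpace H t) (p : V) :
    (fun v => if H.Reachable p v then y v else 0) ∈ eigSpace H t := by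
  rw [mem_eigSpace]
  intro v
  by_cases hv : H.Reachable p v
  · rw [if_pos hv, ← mem_eigSpace.1 hy v]
    refine Finset.sum_congr rfl fun w _ => ?_
    by_cases hw : H.Adj v w
    · simp [hw, hv.trans hw.reachable]
    · simp [hw]
  · rw [if_neg hv, mul_zero]
    refine Finset.sum_eq_zero fun w _ => ?_
    by_cases hw : H.Adj v w
    · have : ¬ H.Reachable p w := fun h => hv (h.trans hw.symm.reachable)
      simp [this]
    · simp [hw]

/-- The eigenvalue equation at a vertex `c` all of whose neighbours other than `p` and `q` are
pendant, with the values at the pendant vertices eliminated. -/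
theorem eigSpace_apply_of_pendants (ht : t ≠ 0) {y : V → ℝ} (hy : y ∈ eigSpace H t) {c p q : V}
    (hpq : p ≠ q) (hp : H.Adj c p) (hq : H.Adj c q)
    (hc : ∀ z, H.Adj c z → z = p ∨ z = q ∨ OnlyNeighbor H z c) :
    t * t * y c = t * (y p + y q) + ({z | H.Adj c z ∧ z ≠ p ∧ z ≠ q}.ncard : ℝ) * y c := by
  classical
  have h := mem_eigSpace.1 hy c
  have hL : {z | H.Adj c z ∧ z ≠ p ∧ z ≠ q}.ncard =
      (Finset.univ.filter fun z => H.Adj c z ∧ z ≠ p ∧ z ≠ q).card := by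
    rw [← Set.ncard_coe_finset]
    congr 1
    ext; simp
  have hsum : ∑ w, (if H.Adj c w then y w else 0) = y p + y q +
      ∑ w, (if H.Adj c w ∧ w ≠ p ∧ w ≠ q then y w else 0) := by
    have : ∀ w, (if H.Adj c w then y w else 0) = (if w = p then y w else 0) +
        (if w = q then y w else 0) + (if H.Adj c w ∧ w ≠ p ∧ w ≠ q then y w else 0) := by
      intro w
      by_cases h1 : w = p
      · subst h1; simp [hp, hpq]
      · by_cases h2 : w = q
        · subst h2; simp [hq, h1]
        · simp [h1, h2]
    rw [Finset.sum_congr rfl fun w _ => this w, Finset.sum_add_distrib, Finset.sum_add_distrib]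
    simp
  have hpend : ∑ w, (if H.Adj c w ∧ w ≠ p ∧ w ≠ q then y w else 0) =
      ({z | H.Adj c z ∧ z ≠ p ∧ z ≠ q}.ncard : ℝ) * (y c / t) := by
    rw [hL, ← Finset.sum_filter, ← nsmul_eq_mul]
    refine Finset.sum_eq_card_nsmul fun w hw => ?_
    obtain ⟨-, h1, h2, h3⟩ := Finset.mem_filter.1 hw
    rw [eq_div_iff ht, mul_comm]
    exact eigSpace_apply_pendant hy h1.symm (((hc w h1).resolve_left h2).resolve_left h3)
  rw [hsum, hpend] at h
  have h2 : t * t * y c = t * (t * y c) := by ring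
  rw [h2, ← h]
  field_simp

/-- If the vectors of `E` vanishing at `v` lie in `E'`, then `dim E ≤ dim E' + 1`, and equality
forces `E' ≤ E`. -/
theorem finrank_le_add_one_of_apply (E E' : Submodule ℝ (V → ℝ)) (v : V)
    (h : ∀ y ∈ E, y v = 0 → y ∈ E') :
    Module.finrank ℝ E ≤ Module.finrank ℝ E' + 1 ∧
      (Module.finrank ℝ E = Module.finrank ℝ E' + 1 → E' ≤ E ∧ ∃ y ∈ E, y v ≠ 0) := by
  let f : E →ₗ[ℝ] ℝ := (LinearMap.proj v).domRestrict E
  have hf : ∀ y : E, f y = (y : V → ℝ) v := fun y => rfl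
  let K := (LinearMap.ker f).map E.subtype
  have hKE : K ≤ E := Submodule.map_subtype_le _ _
  have hKE' : K ≤ E' := by
    rintro _ ⟨y, hy, rfl⟩
    exact h y y.2 (by rw [← hf]; exact hy)
  have hK : Module.finrank ℝ K = Module.finrank ℝ (LinearMap.ker f) :=
    Submodule.finrank_map_subtype_eq _ _
  have hrn := f.finrank_range_add_finrank_ker
  have hle : Module.finrank ℝ (LinearMap.range f) ≤ 1 := by
    simpa using Submodule.finrank_le (LinearMap.range f)
  have hKle := Submodule.finrank_mono hKE'
  refine ⟨by omega, fun heq => ⟨?_, ?_⟩⟩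
  · have : K = E' := Submodule.eq_of_le_of_finrank_eq hKE' (by omega)
    rw [← this]; exact hKE
  · by_contra! hno
    have : LinearMap.range f = ⊥ := by
      rw [LinearMap.range_eq_bot]
      ext y
      exact hno y y.2
    rw [this, finrank_bot] at hrn
    omega

end Eigenspace

/-! ### Acyclic graphs have a vertex with at most one non-pendant neighbour -/

theorem reachable_isolate_of_walk {H : SimpleGraph V} {x a b : V} (p : H.Walk a b)
    (hx : x ∉ p.support) {c : V} (hc : c ∈ p.support) : (isolate H {x}).Reachable a c := by
  induction p with
  | nil =>
    rw [Walk.support_nil, List.mem_singleton] at hc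
    rw [hc]
  | @cons a d b had p ih =>
    rw [Walk.support_cons, List.mem_cons] at hc
    rw [Walk.support_cons, List.mem_cons, not_or] at hx
    rcases hc with rfl | hc
    · exact Reachable.refl _
    · have hd : (isolate H {x}).Adj a d :=
        ⟨had, fun h => hx.1 (Set.mem_singleton_iff.1 h).symm,
          fun h => hx.2 (Set.mem_singleton_iff.1 h ▸ p.start_mem_support)⟩
      exact hd.reachable.trans (ih hx.2 hc)

theorem isCyclicVertex_of_walk {H : SimpleGraph V} {x a b c : V} (p : H.Walk a b)
    (hx : x ∉ p.support) (hc : c ∈ p.support) (hac : a ≠ c) (ha : H.Adj x a) (hxc : H.Adj x c) :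
    IsCyclicVertex H x :=
  ⟨a, c, hac, ha, hxc, reachable_isolate_of_walk p hx hc⟩

/-- The second vertex `v` of a longest path has this property: its neighbours other than the third
vertex `w` are ends of longest paths, and such ends are pendant. -/
theorem exists_almost_pendant [Finite V] {H : SimpleGraph V} (hac : ∀ x, ¬ IsCyclicVertex H x)
    {a₀ b₀ : V} (h₀ : H.Adj a₀ b₀) :
    ∃ v w u, H.Adj v w ∧ H.Adj v u ∧ OnlyNeighbor H u v ∧
      ∀ z, H.Adj v z → z ≠ w → OnlyNeighbor H z v := by
  classical
  have := Fintype.ofFinite V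
  set S : Set ℕ := {n | ∃ (a b : V) (p : H.Walk a b), p.IsPath ∧ p.length = n} with hS
  have hbdd : BddAbove S := by
    refine ⟨Fintype.card V, ?_⟩
    rintro n ⟨a, b, p, hp, rfl⟩
    exact hp.length_lt.le
  obtain ⟨a, b, p, hp, hlen⟩ : sSup S ∈ S :=
    Nat.sSup_mem ⟨0, a₀, a₀, Walk.nil, by simp, rfl⟩ hbdd
  have hmax : ∀ (c d : V) (q : H.Walk c d), q.IsPath → q.length ≤ p.length := by
    intro c d q hq
    rw [hlen]
    exact le_csSup hbdd ⟨c, d, q, hq, rfl⟩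
  have h1 : 1 ≤ p.length := by
    have := hmax a₀ b₀ (Walk.cons h₀ Walk.nil) (by simp [h₀.ne])
    simpa using this
  -- The first vertex of a longest path is pendant.
  have hend : ∀ (c v d : V) (hcv : H.Adj c v) (q : H.Walk v d), (Walk.cons hcv q).IsPath →
      (Walk.cons hcv q).length = p.length → OnlyNeighbor H c v := by
    intro c v d hcv q hq hl z hz
    by_contra hzv
    by_cases hzs : z ∈ (Walk.cons hcv q).support
    · have hcq := (Walk.cons_isPath_iff _ _).1 hq
      rw [Walk.support_cons, List.mem_cons] at hzs
      rcases hzs with rfl | hzs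
      · exact H.loopless.irrefl _ hz
      · exact hac c (isCyclicVertex_of_walk q hcq.2 hzs (Ne.symm hzv) hcv hz)
    · have := hmax z d (Walk.cons hz.symm (Walk.cons hcv q)) (hq.cons hzs)
      rw [Walk.length_cons] at this
      omega
  cases p with
  | nil => simp at h1
  | @cons _ v _ hav q =>
    have ha := hend a v b hav q hp rfl
    have hq := ((Walk.cons_isPath_iff _ _).1 hp).1
    have hout : ∀ z, H.Adj v z → z ∉ q.support → OnlyNeighbor H z v := fun z hz hzq =>
      hend z v b hz.symm q (hq.cons hzq) (by simp)
    cases q with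
    | nil =>
      refine ⟨_, a, a, hav.symm, hav.symm, ha, fun z hz _ => hout z hz ?_⟩
      rw [Walk.support_nil, List.mem_singleton]
      exact hz.ne'
    | @cons _ w _ hvw r =>
      refine ⟨v, w, a, hvw, hav.symm, ha, fun z hz hzw => hout z hz fun hzs => ?_⟩
      rw [Walk.support_cons, List.mem_cons] at hzs
      rcases hzs with rfl | hzs
      · exact H.loopless.irrefl _ hz
      · exact hac v (isCyclicVertex_of_walk r ((Walk.cons_isPath_iff _ _).1 hq).2 hzs
          (Ne.symm hzw) hvw hz)

/-! ### The inequality, and the support of the eigenspace in the case of equality -/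

section Bound

variable [Fintype V] {H : SimpleGraph V} {t : ℝ}

/-- Every non-isolated vertex of `H` is in the support of some vector of the `t`-eigenspace. -/
def FullSupport (H : SimpleGraph V) (t : ℝ) : Prop :=
  ∀ u a, H.Adj u a → ∃ y ∈ eigSpace H t, y u ≠ 0

/-- The inequality `m_t(H) ≤ β'(H) + c(H)`. -/
def MultLe (H : SimpleGraph V) (t : ℝ) : Prop :=
  (Module.finrank ℝ (eigSpace H t) : ℤ) ≤ inducedMatchingNumber H + cyclomaticNumber H

/-- The equality `m_t(H) = β'(H) + c(H)`. -/
def MultEq (H : SimpleGraph V) (t : ℝ) : Prop :=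
  (Module.finrank ℝ (eigSpace H t) : ℤ) = inducedMatchingNumber H + cyclomaticNumber H

theorem card_edgeSet_lt {H' H : SimpleGraph V} (hle : H' ≤ H) {a b : V} (h : H.Adj a b)
    (h' : ¬ H'.Adj a b) : Nat.card H'.edgeSet < Nat.card H.edgeSet := by
  rw [Nat.card_coe_set_eq, Nat.card_coe_set_eq]
  refine Set.ncard_lt_ncard ⟨edgeSet_mono hle, fun hsub => h' ?_⟩ (Set.toFinite _)
  exact hsub (show s(a, b) ∈ H.edgeSet from h)

theorem finrank_isolate_singleton (x : V) :
    Module.finrank ℝ (eigSpace H t) ≤ Module.finrank ℝ (eigSpace (isolate H {x}) t) + 1 ∧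
      (Module.finrank ℝ (eigSpace H t) = Module.finrank ℝ (eigSpace (isolate H {x}) t) + 1 →
        eigSpace (isolate H {x}) t ≤ eigSpace H t ∧ ∃ y ∈ eigSpace H t, y x ≠ 0) :=
  finrank_le_add_one_of_apply _ _ x fun y hy h0 => mem_eigSpace_isolate hy
    (by rintro v hv; rw [Set.mem_singleton_iff.1 hv]; exact h0)

/-- Deletion of a cyclic vertex: the bound is inherited, and in the case of equality the
multiplicity and the cyclomatic number drop by exactly one. -/
theorem multLe_of_isolate_cyclic {x p q : V} (hpq : p ≠ q) (hp : H.Adj x p) (hq : H.Adj x q)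
    (hr : (isolate H {x}).Reachable p q) (hle : MultLe (isolate H {x}) t) :
    MultLe H t ∧ (MultEq H t → MultEq (isolate H {x}) t ∧
      cyclomaticNumber (isolate H {x}) + 1 = cyclomaticNumber H ∧
      eigSpace (isolate H {x}) t ≤ eigSpace H t ∧ ∃ y ∈ eigSpace H t, y x ≠ 0) := by
  obtain ⟨h1, h2⟩ := finrank_isolate_singleton (H := H) (t := t) x
  have h3 := cyclomaticNumber_isolate_add_one_le hpq hp hq hr
  have h4 := inducedMatchingNumber_isolate_le H {x}
  unfold MultLe MultEq at *
  refine ⟨by omega, fun heq => ⟨by omega, by omega, h2 (by omega)⟩⟩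

/-- Deletion of the closed neighbourhood of a vertex `v` with a pendant neighbour and at most one
non-pendant neighbour `w`: an eigenvector that vanishes at `v` vanishes at the pendant neighbours
and hence, by the equation at `v`, also at `w`. -/
theorem multLe_of_isolate_star (ht : t ≠ 0) {v w u : V} (hvw : H.Adj v w) (hvu : H.Adj v u)
    (hu : OnlyNeighbor H u v) (hz : ∀ z, H.Adj v z → z ≠ w → OnlyNeighbor H z v)
    (hle : MultLe (isolate H {z | z = v ∨ H.Adj v z}) t) :
    MultLe H t ∧ (MultEq H t → MultEq (isolate H {z | z = v ∨ H.Adj v z}) t ∧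
      eigSpace (isolate H {z | z = v ∨ H.Adj v z}) t ≤ eigSpace H t ∧
      ∃ y ∈ eigSpace H t, y v ≠ 0) := by
  classical
  obtain ⟨h1, h2⟩ := finrank_le_add_one_of_apply (eigSpace H t)
    (eigSpace (isolate H {z | z = v ∨ H.Adj v z}) t) v (by
      intro y hy h0
      have hpend : ∀ z, H.Adj v z → z ≠ w → y z = 0 := by
        intro z hvz hzw
        have := eigSpace_apply_pendant hy hvz.symm (hz z hvz hzw)
        rw [h0] at this
        exact (mul_eq_zero.1 this).resolve_left ht
      refine mem_eigSpace_isolate hy ?_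
      rintro z (rfl | hvz)
      · exact h0
      · by_cases hzw : z = w
        · have h := mem_eigSpace.1 hy v
          rw [h0, mul_zero, Finset.sum_eq_single w] at h
          · rw [hzw]
            simpa [hvw] using h
          · intro b _ hb
            by_cases hvb : H.Adj v b
            · simp [hvb, hpend b hvb hb]
            · simp [hvb]
          · simp
        · exact hpend z hvz hzw)
  have h3 := cyclomaticNumber_mono (isolate_le H {z | z = v ∨ H.Adj v z})
  have h4 := inducedMatchingNumber_isolate_add_one_le hvu hu
  unfold MultLe MultEq at *
  refine ⟨by omega, fun heq => ⟨by omega, h2 (by omega)⟩⟩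

/-- If all eigenvectors of `H` minus the closed neighbourhood of `v` extend by zero to `H`, then the
neighbour `w` of `v` has only pendant neighbours besides `v`: a nontrivial component beyond `w`
would be attached by a single edge, and the equation at `w` would fail for an eigenvector supported
on that component and nonzero at its attaching vertex. -/
theorem onlyNeighbor_of_isolate_star (ht : t ≠ 0) (hac : ∀ x, ¬ IsCyclicVertex H x) {v w : V}
    (hvw : H.Adj v w) (hz : ∀ z, H.Adj v z → z ≠ w → OnlyNeighbor H z v)
    (hE : eigSpace (isolate H {z | z = v ∨ H.Adj v z}) t ≤ eigSpace H t)
    (hFS : FullSupport (isolate H {z | z = v ∨ H.Adj v z}) t) :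
    ∀ z, H.Adj w z → z ≠ v → OnlyNeighbor H z w := by
  classical
  intro z hwz hzv a hza
  by_contra haw
  have hz' : ∀ s, H.Adj v s → s ≠ w → ¬ H.Adj s z := fun s hs hsw hsz => hzv (hz s hs hsw z hsz)
  have hvz : ¬ H.Adj v z := fun h => hvw.ne (hz z h hwz.ne' w hwz.symm).symm
  have hva : ¬ H.Adj v a := fun h => hz' a h haw hza.symm
  have hav : a ≠ v := by
    rintro rfl
    exact hvz hza.symm
  set S : Set V := {z | z = v ∨ H.Adj v z} with hS
  have hza' : (isolate H S).Adj z a :=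
    ⟨hza, fun h => h.elim hzv hvz, fun h => h.elim hav hva⟩
  obtain ⟨y, hy, hyz⟩ := hFS z a hza'
  have hy' := component_mem_eigSpace hy z
  set y' : V → ℝ := fun s => if (isolate H S).Reachable z s then y s else 0 with hy'_def
  have hw0 : y' w = 0 := eigSpace_apply_eq_zero ht hy' fun s hs => hs.2.1 (Or.inr hvw)
  have heq := mem_eigSpace.1 (hE hy') w
  rw [hw0, mul_zero, Finset.sum_eq_single z] at heq
  · rw [if_pos hwz] at heq
    exact hyz (by simpa [hy'_def] using heq)
  · intro s _ hsz
    by_cases hws : H.Adj w s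
    · rw [if_pos hws, hy'_def]
      refine if_neg fun hr => hac w ⟨z, s, Ne.symm hsz, hwz, hws, hr.mono ?_⟩
      exact isolate_anti H (by rintro _ rfl; exact Or.inr hvw)
    · exact if_neg hws
  · simp

/-- The bound for all graphs, together with full support in the case of equality, which carries the
induction. -/
theorem multLe_and_fullSupport (ht : t ≠ 0) (H : SimpleGraph V) :
    MultLe H t ∧ (MultEq H t → FullSupport H t) := by
  induction hn : Nat.card H.edgeSet using Nat.strong_induction_on generalizing H with
  | _ n ih =>
  subst hn
  by_cases hcyc : ∃ x, IsCyclicVertex H x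
  · obtain ⟨x, p, q, hpq, hp, hq, hr⟩ := hcyc
    obtain ⟨ih1, ih2⟩ := ih _ (card_edgeSet_lt (isolate_le H {x}) hp fun h => h.2.1 rfl) _ rfl
    obtain ⟨h1, h2⟩ := multLe_of_isolate_cyclic hpq hp hq hr ih1
    refine ⟨h1, fun heq u a hua => ?_⟩
    obtain ⟨heq', -, hE, y, hy, hyx⟩ := h2 heq
    by_cases hux : u = x
    · exact ⟨y, hy, hux ▸ hyx⟩
    by_cases hiso : ∃ b, (isolate H {x}).Adj u b
    · obtain ⟨b, hb⟩ := hiso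
      obtain ⟨z, hz, hzu⟩ := ih2 heq' u b hb
      exact ⟨z, hE hz, hzu⟩
    · push Not at hiso
      have hu : OnlyNeighbor H u x := by
        intro b hb
        by_contra hbx
        exact hiso b ⟨hb, hux, hbx⟩
      refine ⟨y, hy, fun h0 => hyx ?_⟩
      rw [← eigSpace_apply_pendant hy (hu a hua ▸ hua) hu, h0, mul_zero]
  · push Not at hcyc
    by_cases hedge : ∃ a b, H.Adj a b
    · obtain ⟨a₀, b₀, h₀⟩ := hedge
      obtain ⟨v, w, l, hvw, hvl, hl, hz⟩ := exists_almost_pendant hcyc h₀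
      obtain ⟨ih1, ih2⟩ := ih _ (card_edgeSet_lt (isolate_le H {z | z = v ∨ H.Adj v z}) hvw
        fun h => h.2.1 (Or.inl rfl)) _ rfl
      obtain ⟨h1, h2⟩ := multLe_of_isolate_star ht hvw hvl hl hz ih1
      refine ⟨h1, fun heq u a hua => ?_⟩
      obtain ⟨heq', hE, y, hy, hyv⟩ := h2 heq
      have hw := onlyNeighbor_of_isolate_star ht hcyc hvw hz hE (ih2 heq')
      have hyw : y w ≠ 0 := by
        classical
        intro h0
        have h := mem_eigSpace.1 hy w
        rw [h0, mul_zero, Finset.sum_eq_single v, if_pos hvw.symm] at h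
        · exact hyv h
        · intro s _ hsv
          by_cases hws : H.Adj w s
          · have := eigSpace_apply_pendant hy hws.symm (hw s hws hsv)
            rw [h0] at this
            rw [if_pos hws]
            exact (mul_eq_zero.1 this).resolve_left ht
          · exact if_neg hws
        · simp
      by_cases hiso : ∃ b, (isolate H {z | z = v ∨ H.Adj v z}).Adj u b
      · obtain ⟨b, hb⟩ := hiso
        obtain ⟨z, hz, hzu⟩ := ih2 heq' u b hb
        exact ⟨z, hE hz, hzu⟩
      refine ⟨y, hy, ?_⟩
      by_cases huv : u = v
      · rwa [huv]
      by_cases huw : u = w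
      · rwa [huw]
      by_cases hvu : H.Adj v u
      · intro h0
        apply hyv
        rw [← eigSpace_apply_pendant hy hvu.symm (hz u hvu huw), h0, mul_zero]
      by_cases hwa : a = w
      · intro h0
        apply hyw
        rw [← eigSpace_apply_pendant hy (hwa ▸ hua) (hw u (hwa ▸ hua).symm huv), h0, mul_zero]
      · exfalso
        refine hiso ⟨a, hua, fun h => h.elim huv hvu, ?_⟩
        rintro (rfl | hva)
        · exact hvu hua.symm
        · exact huv (hz a hva hwa u hua.symm)
    · push Not at hedge
      have hbot : H = ⊥ := by
        ext a b
        exact ⟨fun h => hedge a b h, fun h => h.elim⟩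
      refine ⟨?_, fun _ u a hua => absurd hua (hedge u a)⟩
      unfold MultLe
      rw [hbot, eigSpace_bot ht, cyclomaticNumber_bot, finrank_bot]
      positivity

/-- A forest attaining equality has a component that is a star or a double star: all neighbours of
`v` and `w` other than `v` and `w` themselves are pendant. -/
theorem exists_double_star (ht : t ≠ 0) (heq : MultEq H t) (hac : ∀ x, ¬ IsCyclicVertex H x)
    {a₀ b₀ : V} (h₀ : H.Adj a₀ b₀) :
    ∃ v w, H.Adj v w ∧ (∀ z, H.Adj v z → z ≠ w → OnlyNeighbor H z v) ∧
      ∀ z, H.Adj w z → z ≠ v → OnlyNeighbor H z w := by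
  obtain ⟨v, w, l, hvw, hvl, hl, hz⟩ := exists_almost_pendant hac h₀
  obtain ⟨h1, h2⟩ := multLe_and_fullSupport ht (isolate H {z | z = v ∨ H.Adj v z})
  obtain ⟨heq', hE, -⟩ := (multLe_of_isolate_star ht hvw hvl hl hz h1).2 heq
  exact ⟨v, w, hvw, hz, onlyNeighbor_of_isolate_star ht hac hvw hz hE (h2 heq')⟩

end Bound

/-! ### Deleting a cyclic vertex of a graph that attains equality -/

section Structure

variable [Fintype V] {H : SimpleGraph V} {t : ℝ}

/-- Any two non-isolated vertices are connected: up to isolated vertices, `H` is connected. -/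
def EssConnected (H : SimpleGraph V) : Prop :=
  ∀ a a' b b', H.Adj a a' → H.Adj b b' → H.Reachable a b

/-- The consequences of equality for a cyclic vertex `x` with connected neighbours `p`, `q`. -/
structure CyclicSplit (H : SimpleGraph V) (t : ℝ) (x p q : V) : Prop where
  ne : p ≠ q
  adj_left : H.Adj x p
  adj_right : H.Adj x q
  reachable : (isolate H {x}).Reachable p q
  multEq : MultEq (isolate H {x}) t
  le : eigSpace (isolate H {x}) t ≤ eigSpace H t
  fullSupport : FullSupport (isolate H {x}) t
  pendant : ∀ z, H.Adj x z → z = p ∨ z = q ∨ OnlyNeighbor H z x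
  sum_eq_zero : ∀ y ∈ eigSpace (isolate H {x}) t, y p + y q = 0

/-- A third non-pendant neighbour `r` of `x` is impossible: if `r` is connected to `p` in `H - x`, the
cyclomatic number drops by two; otherwise full support at `r` forces a second edge from `x` to the
component of `r`, and the cyclomatic number drops by two again. -/
theorem cyclicSplit (ht : t ≠ 0) (heq : MultEq H t) {x p q : V} (hpq : p ≠ q) (hp : H.Adj x p)
    (hq : H.Adj x q) (hr : (isolate H {x}).Reachable p q) : CyclicSplit H t x p q := by
  classical
  obtain ⟨h1, h2⟩ := multLe_and_fullSupport ht (isolate H {x})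
  obtain ⟨heq', hc, hE, -⟩ := (multLe_of_isolate_cyclic hpq hp hq hr h1).2 heq
  have hFS := h2 heq'
  have hx0 : ∀ y ∈ eigSpace (isolate H {x}) t, y x = 0 := fun y hy =>
    eigSpace_apply_eq_zero ht hy fun w hw => hw.2.1 rfl
  have hpend : ∀ z, H.Adj x z → z = p ∨ z = q ∨ OnlyNeighbor H z x := by
    intro r hxr
    by_contra! hcon
    obtain ⟨hrp, hrq, hron⟩ := hcon
    simp only [OnlyNeighbor, not_forall] at hron
    obtain ⟨a, hra, hax⟩ := hron
    have hra' : (isolate H {x}).Adj r a := ⟨hra, hxr.ne', hax⟩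
    by_cases hpr : (isolate H {x}).Reachable p r
    · have := cyclomaticNumber_isolate_add_two_le hrq.symm hpq hpq hrp.symm hp hq hp hxr hr hpr
      omega
    · obtain ⟨y, hy, hyr⟩ := hFS r a hra'
      have hy' := component_mem_eigSpace hy r
      set y' : V → ℝ := fun s => if (isolate H {x}).Reachable r s then y s else 0 with hy'_def
      have hsum := mem_eigSpace.1 (hE hy') x
      rw [hx0 _ hy', mul_zero] at hsum
      have : ∃ s, s ≠ r ∧ H.Adj x s ∧ (isolate H {x}).Reachable r s := by
        by_contra! hno
        rw [Finset.sum_eq_single r, if_pos hxr] at hsum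
        · exact hyr (by simpa [hy'_def] using hsum)
        · intro s _ hsr
          by_cases hxs : H.Adj x s
          · rw [if_pos hxs]
            exact if_neg (hno s hsr hxs)
          · exact if_neg hxs
        · simp
      obtain ⟨s, hsr, hxs, hrs⟩ := this
      have hsq : q ≠ s := by
        rintro rfl
        exact hpr (hr.trans hrs.symm)
      have := cyclomaticNumber_isolate_add_two_le hsq hpq hrq hsr.symm hp hq hxr hxs hr hrs
      omega
  refine ⟨hpq, hp, hq, hr, heq', hE, hFS, hpend, fun y hy => ?_⟩
  have hsum := mem_eigSpace.1 (hE hy) x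
  rw [hx0 _ hy, mul_zero] at hsum
  rw [← hsum]
  have : ∀ w, (if H.Adj x w then y w else 0) =
      (if w = p then y w else 0) + (if w = q then y w else 0) := by
    intro w
    by_cases hwp : w = p
    · subst hwp; simp [hp, hpq]
    by_cases hwq : w = q
    · subst hwq; simp [hq, hwp]
    by_cases hxw : H.Adj x w
    · have hon := ((hpend w hxw).resolve_left hwp).resolve_left hwq
      have : y w = 0 := eigSpace_apply_eq_zero ht hy fun s hs => hs.2.2 (hon s hs.1)
      simp [hwp, hwq, this]
    · simp [hwp, hwq, hxw]
  rw [Finset.sum_congr rfl fun w _ => this w, Finset.sum_add_distrib]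
  simp

theorem CyclicSplit.essConnected {x p q : V} (hs : CyclicSplit H t x p q)
    (hH : EssConnected H) : EssConnected (isolate H {x}) := by
  have key : ∀ a x', H.Reachable a x' → x' = x → (∃ a', (isolate H {x}).Adj a a') →
      (isolate H {x}).Reachable p a := by
    intro a x' hax hx'
    obtain ⟨w⟩ := hax
    induction w with
    | nil =>
      rintro ⟨a', ha'⟩
      exact absurd hx' ha'.2.1
    | @cons a c b hac w ih =>
      rintro ⟨a', ha'⟩
      by_cases hcx : c = x
      · rw [hcx] at hac
        rcases hs.pendant a hac.symm with h | h | h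
        · rw [h]
        · rw [h]
          exact hs.reachable
        · exact absurd (h a' ha'.1) ha'.2.2
      · have hadj : (isolate H {x}).Adj a c := ⟨hac, ha'.2.1, hcx⟩
        exact (ih hx' ⟨a, hadj.symm⟩).trans hadj.symm.reachable
  intro a a' b b' ha hb
  exact (key a x (hH a a' x p ha.1 hs.adj_left) rfl ⟨a', ha⟩).symm.trans
    (key b x (hH b b' x p hb.1 hs.adj_left) rfl ⟨b', hb⟩)

end Structure

/-! ### The graphs that attain equality -/

section Classification

/-- Any two non-isolated vertices are joined by a walk of length at most three. -/
def DiamLeThree (H : SimpleGraph V) : Prop :=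
  ∀ a a' b b', H.Adj a a' → H.Adj b b' → ∃ w : H.Walk a b, w.length ≤ 3

/-- If every edge leaving `C` ends in a pendant vertex, then `C` and the pendant vertices attached
to it exhaust the non-isolated vertices. -/
theorem EssConnected.mem_or_pendant {H : SimpleGraph V} (hH : EssConnected H) {C : Set V}
    (hC : ∀ c ∈ C, ∀ z, H.Adj c z → z ∈ C ∨ OnlyNeighbor H z c) {c c' : V} (hc : c ∈ C)
    (hcc' : H.Adj c c') {a a' : V} (ha : H.Adj a a') :
    a ∈ C ∨ ∃ d ∈ C, H.Adj d a ∧ OnlyNeighbor H a d := by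
  obtain ⟨w⟩ := hH c c' a a' hcc' ha
  have key : ∀ {s r : V} (_ : H.Walk s r), (s ∈ C ∨ ∃ d ∈ C, H.Adj d s ∧ OnlyNeighbor H s d) →
      (r ∈ C ∨ ∃ d ∈ C, H.Adj d r ∧ OnlyNeighbor H r d) := by
    intro s r w
    induction w with
    | nil => exact id
    | @cons s u r hsu w ih =>
      intro hs
      refine ih ?_
      rcases hs with hs | ⟨d, hd, hds, hon⟩
      · exact (hC s hs u hsu).imp id fun h => ⟨s, hs, hsu, h⟩
      · rw [hon u hsu]
        exact Or.inl hd
  exact key w (Or.inl hc)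

theorem DiamLeThree.of_core {H : SimpleGraph V} (hH : EssConnected H) {C : Set V}
    (hC : ∀ c ∈ C, ∀ z, H.Adj c z → z ∈ C ∨ OnlyNeighbor H z c) {c c' : V} (hc : c ∈ C)
    (hcc' : H.Adj c c') (hclique : ∀ c ∈ C, ∀ d ∈ C, c ≠ d → H.Adj c d) : DiamLeThree H := by
  have hnear : ∀ a a', H.Adj a a' → ∃ d ∈ C, ∃ w : H.Walk a d, w.length ≤ 1 := by
    intro a a' ha
    rcases hH.mem_or_pendant hC hc hcc' ha with h | ⟨d, hd, hda, -⟩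
    · exact ⟨a, h, Walk.nil, by simp⟩
    · exact ⟨d, hd, hda.symm.toWalk, by simp⟩
  intro a a' b b' ha hb
  obtain ⟨d, hd, w, hw⟩ := hnear a a' ha
  obtain ⟨e, he, u, hu⟩ := hnear b b' hb
  have hmid : ∃ m : H.Walk d e, m.length ≤ 1 := by
    by_cases hde : d = e
    · subst hde
      exact ⟨Walk.nil, by simp⟩
    · exact ⟨(hclique d hd e he hde).toWalk, by simp⟩
  obtain ⟨m, hm⟩ := hmid
  refine ⟨(w.append m).append u.reverse, ?_⟩
  rw [Walk.length_append, Walk.length_append, Walk.length_reverse]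
  omega

/-- The vertices `x`, `p`, `q` form a triangle, each of them has `t² + t` further neighbours, and
these are pendant. -/
structure IsTriangleCore (H : SimpleGraph V) (t : ℝ) (x p q : V) : Prop where
  adj_xp : H.Adj x p
  adj_pq : H.Adj p q
  adj_xq : H.Adj x q
  pendant_x : ∀ z, H.Adj x z → z = p ∨ z = q ∨ OnlyNeighbor H z x
  pendant_p : ∀ z, H.Adj p z → z = x ∨ z = q ∨ OnlyNeighbor H z p
  pendant_q : ∀ z, H.Adj q z → z = x ∨ z = p ∨ OnlyNeighbor H z q
  card_x : ({z | H.Adj x z ∧ z ≠ p ∧ z ≠ q}.ncard : ℝ) = t * t + t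
  card_p : ({z | H.Adj p z ∧ z ≠ x ∧ z ≠ q}.ncard : ℝ) = t * t + t
  card_q : ({z | H.Adj q z ∧ z ≠ x ∧ z ≠ p}.ncard : ℝ) = t * t + t

/-- The vertices `x, p, v, w, q` form, in this cyclic order, a closed walk of length five without
repeated vertices. -/
structure IsPentagon (H : SimpleGraph V) (x p v w q : V) : Prop where
  adj_xp : H.Adj x p
  adj_pv : H.Adj p v
  adj_vw : H.Adj v w
  adj_wq : H.Adj w q
  adj_qx : H.Adj q x
  ne_xv : x ≠ v
  ne_pw : p ≠ w
  ne_vq : v ≠ q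
  ne_wx : w ≠ x
  ne_qp : q ≠ p

theorem IsPentagon.rotate {H : SimpleGraph V} {x p v w q : V} (h : IsPentagon H x p v w q) :
    IsPentagon H p v w q x :=
  ⟨h.adj_pv, h.adj_vw, h.adj_wq, h.adj_qx, h.adj_xp, h.ne_pw, h.ne_vq, h.ne_wx, h.ne_qp, h.ne_xv⟩

/-- A pentagon whose vertices have no further neighbours. -/
structure IsPentagonComponent (H : SimpleGraph V) (x p v w q : V) : Prop
    extends IsPentagon H x p v w q where
  nbr_x : ∀ z, H.Adj x z → z = p ∨ z = q
  nbr_p : ∀ z, H.Adj p z → z = x ∨ z = v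
  nbr_v : ∀ z, H.Adj v z → z = p ∨ z = w
  nbr_w : ∀ z, H.Adj w z → z = v ∨ z = q
  nbr_q : ∀ z, H.Adj q z → z = w ∨ z = x

variable {H : SimpleGraph V} {t : ℝ}

theorem IsTriangleCore.mem_core {x p q : V} (h : IsTriangleCore H t x p q) :
    ∀ c ∈ ({x, p, q} : Set V), ∀ z, H.Adj c z → z ∈ ({x, p, q} : Set V) ∨ OnlyNeighbor H z c := by
  rintro c (rfl | rfl | rfl) z hz
  · rcases h.pendant_x z hz with rfl | rfl | h' <;> simp_all
  · rcases h.pendant_p z hz with rfl | rfl | h' <;> simp_all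
  · rcases h.pendant_q z hz with rfl | rfl | h' <;> simp_all

theorem IsPentagonComponent.mem_of_adj {x p v w q : V} (h : IsPentagonComponent H x p v w q)
    (hH : EssConnected H) {a a' : V} (ha : H.Adj a a') :
    a = x ∨ a = p ∨ a = v ∨ a = w ∨ a = q := by
  have hC : ∀ c ∈ ({x, p, v, w, q} : Set V), ∀ z, H.Adj c z → z ∈ ({x, p, v, w, q} : Set V) := by
    rintro c (rfl | rfl | rfl | rfl | rfl) z hz
    · rcases h.nbr_x z hz with rfl | rfl <;> simp
    · rcases h.nbr_p z hz with rfl | rfl <;> simp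
    · rcases h.nbr_v z hz with rfl | rfl <;> simp
    · rcases h.nbr_w z hz with rfl | rfl <;> simp
    · rcases h.nbr_q z hz with rfl | rfl <;> simp
  have := hH.mem_or_pendant (C := {x, p, v, w, q}) (fun c hc z hz => Or.inl (hC c hc z hz))
    (c := x) (by simp) h.adj_xp ha
  have hmem : a ∈ ({x, p, v, w, q} : Set V) := by
    rcases this with h' | ⟨d, hd, hda, -⟩
    · exact h'
    · exact hC d hd a hda
  simpa using hmem

theorem IsPentagon.exists_walk {x p v w q : V} (h : IsPentagon H x p v w q) {b : V}
    (hb : b = x ∨ b = p ∨ b = v ∨ b = w ∨ b = q) : ∃ k : H.Walk x b, k.length ≤ 3 := by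
  rcases hb with rfl | rfl | rfl | rfl | rfl
  · exact ⟨Walk.nil, by simp⟩
  · exact ⟨h.adj_xp.toWalk, by simp⟩
  · exact ⟨Walk.cons h.adj_xp h.adj_pv.toWalk, by simp⟩
  · exact ⟨Walk.cons h.adj_qx.symm h.adj_wq.symm.toWalk, by simp⟩
  · exact ⟨h.adj_qx.symm.toWalk, by simp⟩

variable [Fintype V]

theorem CyclicSplit.apply_eq_zero (ht : t ≠ 0) {x p q : V} (_ : CyclicSplit H t x p q)
    {y : V → ℝ} (hy : y ∈ eigSpace (isolate H {x}) t) : y x = 0 :=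
  eigSpace_apply_eq_zero ht hy fun _ hw => hw.2.1 rfl

theorem cyclicSplit_of_triangle (ht : t ≠ 0) (heq : MultEq H t) {x p q : V} (hxp : H.Adj x p)
    (hpq : H.Adj p q) (hxq : H.Adj x q) : CyclicSplit H t x p q :=
  cyclicSplit ht heq hpq.ne hxp hxq
    (Adj.reachable (⟨hpq, hxp.ne', hxq.ne'⟩ : (isolate H {x}).Adj p q))

theorem card_pendants_of_triangle (ht : t ≠ 0) (heq : MultEq H t) {x p q : V} (hxp : H.Adj x p)
    (hpq : H.Adj p q) (hxq : H.Adj x q) :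
    ({z | H.Adj p z ∧ z ≠ x ∧ z ≠ q}.ncard : ℝ) = t * t + t := by
  have hx := cyclicSplit_of_triangle ht heq hxp hpq hxq
  have hp := cyclicSplit_of_triangle ht heq hxp.symm hxq hpq
  obtain ⟨y, hy, hyp⟩ := hx.fullSupport p q ⟨hpq, hxp.ne', hxq.ne'⟩
  have h1 := hx.sum_eq_zero y hy
  have h2 := eigSpace_apply_of_pendants ht (hx.le hy) hxq.ne hxp.symm hpq hp.pendant
  rw [hx.apply_eq_zero ht hy, zero_add, eq_neg_of_add_eq_zero_right h1] at h2
  refine mul_right_cancel₀ hyp ?_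
  linarith

theorem isTriangleCore (ht : t ≠ 0) (heq : MultEq H t) {x p q : V} (hxp : H.Adj x p)
    (hpq : H.Adj p q) (hxq : H.Adj x q) : IsTriangleCore H t x p q where
  adj_xp := hxp
  adj_pq := hpq
  adj_xq := hxq
  pendant_x := (cyclicSplit_of_triangle ht heq hxp hpq hxq).pendant
  pendant_p := (cyclicSplit_of_triangle ht heq hxp.symm hxq hpq).pendant
  pendant_q := (cyclicSplit_of_triangle ht heq hxq.symm hxp hpq.symm).pendant
  card_x := card_pendants_of_triangle ht heq hxp.symm hxq hpq
  card_p := card_pendants_of_triangle ht heq hxp hpq hxq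
  card_q := card_pendants_of_triangle ht heq hxq hpq.symm hxp

/-- At the vertex `z` opposite to `x` in a four-cycle `x p z q`, the eigenvectors of `H - x` have
opposite values at `p` and `q`, so that `t²` is the number of pendant vertices at `z`. -/
theorem card_pendants_of_square (ht : t ≠ 0) (heq : MultEq H t) {x p z q : V} (hxp : H.Adj x p)
    (hpz : H.Adj p z) (hzq : H.Adj z q) (hqx : H.Adj q x) (hxz : x ≠ z) (hpq : p ≠ q) :
    CyclicSplit H t x p q ∧ ({s | H.Adj z s ∧ s ≠ p ∧ s ≠ q}.ncard : ℝ) = t * t := by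
  have hsplit : ∀ {a b c d : V}, H.Adj a b → H.Adj b c → H.Adj c d → H.Adj d a → a ≠ c → b ≠ d →
      CyclicSplit H t a b d := by
    intro a b c d hab hbc hcd hda hac hbd
    have h1 : (isolate H {a}).Adj b c := ⟨hbc, hab.ne', hac.symm⟩
    have h2 : (isolate H {a}).Adj c d := ⟨hcd, hac.symm, hda.ne⟩
    exact cyclicSplit ht heq hbd hab hda.symm (h1.reachable.trans h2.reachable)
  have hx := hsplit hxp hpz hzq hqx hxz hpq
  have hz := hsplit hpz.symm hxp.symm hqx.symm hzq.symm hxz.symm hpq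
  refine ⟨hx, ?_⟩
  obtain ⟨y, hy, hyz⟩ := hx.fullSupport z p ⟨hpz.symm, hxz.symm, hxp.ne'⟩
  have h2 := eigSpace_apply_of_pendants ht (hx.le hy) hpq hpz.symm hzq hz.pendant
  rw [hx.sum_eq_zero y hy, mul_zero, zero_add] at h2
  exact (mul_right_cancel₀ hyz h2).symm

/-- With `t²` pendant vertices at each vertex of a four-cycle `x p z q`, the equation at `p` forces
the eigenvectors of `H - x` to vanish at `z`. -/
theorem not_square (ht : t ≠ 0) (heq : MultEq H t) {x p z q : V} (hxp : H.Adj x p)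
    (hpz : H.Adj p z) (hzq : H.Adj z q) (hqx : H.Adj q x) (hxz : x ≠ z) (hpq : p ≠ q) : False := by
  have hx := (card_pendants_of_square ht heq hxp hpz hzq hqx hxz hpq).1
  have hp := (card_pendants_of_square ht heq hpz hzq hqx hxp hpq hxz.symm).1
  have hc := (card_pendants_of_square ht heq hqx hxp hpz hzq hpq.symm hxz).2
  obtain ⟨y, hy, hyz⟩ := hx.fullSupport z p ⟨hpz.symm, hxz.symm, hxp.ne'⟩
  have h2 := eigSpace_apply_of_pendants ht (hx.le hy) hxz hxp.symm hpz
    fun s hs => or_left_comm.1 (hp.pendant s hs)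
  rw [hx.apply_eq_zero ht hy, hc, zero_add] at h2
  have h3 : t * y z = 0 := by linarith
  exact hyz ((mul_eq_zero.1 h3).resolve_left ht)

theorem cyclicSplit_of_pentagon (ht : t ≠ 0) (heq : MultEq H t) {x p v w q : V}
    (h : IsPentagon H x p v w q) : CyclicSplit H t x p q := by
  have h1 : (isolate H {x}).Adj p v := ⟨h.adj_pv, h.adj_xp.ne', h.ne_xv.symm⟩
  have h2 : (isolate H {x}).Adj v w := ⟨h.adj_vw, h.ne_xv.symm, h.ne_wx⟩
  have h3 : (isolate H {x}).Adj w q := ⟨h.adj_wq, h.ne_wx, h.adj_qx.ne⟩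
  exact cyclicSplit ht heq h.ne_qp.symm h.adj_xp h.adj_qx.symm
    ((h1.reachable.trans h2.reachable).trans h3.reachable)

/-- A pendant vertex at `p` would have distance four from `q` in `H - x`. -/
theorem nbr_of_pentagon (ht : t ≠ 0) (heq : MultEq H t) {x p v w q : V}
    (h : IsPentagon H x p v w q) (hD : DiamLeThree (isolate H {x})) :
    ∀ z, H.Adj p z → z = x ∨ z = v := by
  have hp := cyclicSplit_of_pentagon ht heq h.rotate
  have hv := cyclicSplit_of_pentagon ht heq h.rotate.rotate
  have honq : ∀ {s}, OnlyNeighbor H q s → s = w := fun hs => (hs w h.adj_wq.symm).symm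
  have hpq : ¬ H.Adj p q := by
    intro hpq
    rcases hp.pendant q hpq with h' | h' | h'
    · exact h.ne_vq h'.symm
    · exact h.adj_qx.ne h'
    · exact h.ne_pw (honq h')
  have hvq : ¬ H.Adj v q := by
    intro hvq
    rcases hv.pendant q hvq with h' | h' | h'
    · exact h.adj_wq.ne h'.symm
    · exact h.ne_qp h'
    · exact h.adj_vw.ne (honq h')
  intro z hpz
  by_contra! hz
  have hon : OnlyNeighbor H z p := ((hp.pendant z hpz).resolve_left hz.2).resolve_left hz.1
  obtain ⟨k, hk⟩ := hD z p q w ⟨hpz.symm, hz.1, h.adj_xp.ne'⟩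
    ⟨h.adj_wq.symm, h.adj_qx.ne, h.ne_wx⟩
  cases k with
  | nil => exact h.ne_pw (honq hon)
  | @cons _ c _ hc k =>
    obtain rfl := hon c hc.1
    cases k with
    | nil => exact h.ne_qp rfl
    | @cons _ d _ hd k =>
      cases k with
      | nil => exact hpq hd.1
      | @cons _ e _ he k =>
        cases k with
        | nil =>
          rcases hp.pendant d hd.1 with h' | h' | h'
          · exact hvq (h' ▸ he.1)
          · exact hd.2.2 h'
          · exact h.ne_qp (h' q he.1)
        | cons _ _ =>
          simp only [Walk.length_cons] at hk
          omega

theorem isPentagonComponent (ht : t ≠ 0) (heq : MultEq H t) {x p v w q : V}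
    (h : IsPentagon H x p v w q)
    (hD : ∀ x p q, CyclicSplit H t x p q → DiamLeThree (isolate H {x})) :
    IsPentagonComponent H x p v w q := by
  have key : ∀ {x p v w q : V}, IsPentagon H x p v w q → ∀ z, H.Adj p z → z = x ∨ z = v :=
    fun h => nbr_of_pentagon ht heq h (hD _ _ _ (cyclicSplit_of_pentagon ht heq h))
  exact ⟨h, fun z hz => (key h.rotate.rotate.rotate.rotate z hz).symm, key h, key h.rotate,
    key h.rotate.rotate, key h.rotate.rotate.rotate⟩

theorem IsPentagonComponent.eigenvalue_eq (ht : t ≠ 0) (heq : MultEq H t) {x p v w q : V}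
    (h : IsPentagonComponent H x p v w q) : t * t + t = 1 := by
  have hx := cyclicSplit_of_pentagon ht heq h.toIsPentagon
  obtain ⟨y, hy, hyp⟩ := hx.fullSupport p v ⟨h.adj_pv, h.adj_xp.ne', h.ne_xv.symm⟩
  have hsum := hx.sum_eq_zero y hy
  have key : ∀ {c a b : V}, a ≠ b → H.Adj c a → H.Adj c b → (∀ z, H.Adj c z → z = a ∨ z = b) →
      t * y c = y a + y b := by
    intro c a b hab ha hb hc
    have h1 := eigSpace_apply_of_pendants ht (hx.le hy) hab ha hb
      fun z hz => (hc z hz).imp id Or.inl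
    have h2 : {z | H.Adj c z ∧ z ≠ a ∧ z ≠ b} = ∅ := by
      ext z
      simp only [Set.mem_ofPred_eq, Set.mem_empty_iff_false, iff_false]
      rintro ⟨hz, hza, hzb⟩
      exact (hc z hz).elim hza hzb
    rw [h2, Set.ncard_empty, Nat.cast_zero, zero_mul, add_zero, mul_assoc] at h1
    exact mul_left_cancel₀ ht h1
  have hx0 := hx.apply_eq_zero ht hy
  have h1 := key h.ne_xv h.adj_xp.symm h.adj_pv h.nbr_p
  have h2 := key h.ne_pw h.adj_pv.symm h.adj_vw h.nbr_v
  have h3 := key h.ne_wx h.adj_wq.symm h.adj_qx h.nbr_q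
  refine mul_right_cancel₀ hyp ?_
  have hq : y q = - y p := by linarith
  rw [hx0, zero_add] at h1
  rw [hx0, add_zero, hq] at h3
  rw [← h1, ← h3] at h2
  linarith

/-- For a cyclic vertex `x` with connected neighbours `p`, `q`, the bound on the diameter of `H - x`
leaves the distances one, two and three between `p` and `q`: a triangle, a square, a pentagon. -/
theorem classification (ht : t ≠ 0) (heq : MultEq H t)
    (hD : ∀ x p q, CyclicSplit H t x p q → DiamLeThree (isolate H {x})) :
    (∀ x, ¬ IsCyclicVertex H x) ∨ (∃ x p q, IsTriangleCore H t x p q) ∨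
      ∃ x p v w q, IsPentagonComponent H x p v w q := by
  by_cases hcyc : ∃ x, IsCyclicVertex H x
  · right
    obtain ⟨x, p, q, hpq, hp, hq, hr⟩ := hcyc
    have hx := cyclicSplit ht heq hpq hp hq hr
    obtain ⟨p', hp'⟩ := exists_adj_of_reachable_ne hr hpq
    obtain ⟨q', hq'⟩ := exists_adj_of_reachable_ne hr.symm hpq.symm
    obtain ⟨k, hk⟩ := hD x p q hx p p' q q' hp' hq'
    have hsquare : ∀ {z}, (isolate H {x}).Adj p z → (isolate H {x}).Adj z q → False :=
      fun h1 h2 => not_square ht heq hp h1.1 h2.1 hq.symm (fun h => h1.2.2 h.symm) hpq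
    by_cases hadj : (isolate H {x}).Adj p q
    · exact Or.inl ⟨x, p, q, isTriangleCore ht heq hp hadj.1 hq⟩
    right
    cases k with
    | nil => exact absurd rfl hpq
    | @cons _ v _ hpv k =>
      cases k with
      | nil => exact absurd hpv hadj
      | @cons _ w _ hvw k =>
        cases k with
        | nil => exact (hsquare hpv hvw).elim
        | @cons _ e _ hwq k =>
          cases k with
          | nil =>
            refine ⟨x, p, v, w, q, isPentagonComponent ht heq ⟨hp, hpv.1, hvw.1, hwq.1, hq.symm,
              fun h => hpv.2.2 h.symm, ?_, ?_, hvw.2.2, hpq.symm⟩ hD⟩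
            · rintro rfl
              exact hadj hwq
            · rintro rfl
              exact hadj hpv
          | cons _ _ =>
            simp only [Walk.length_cons] at hk
            omega
  · push Not at hcyc
    exact Or.inl hcyc

theorem diamLeThree (ht : t ≠ 0) (H : SimpleGraph V) (heq : MultEq H t) (hH : EssConnected H) :
    DiamLeThree H := by
  induction hn : Nat.card H.edgeSet using Nat.strong_induction_on generalizing H with
  | _ n ih =>
  subst hn
  have hD : ∀ x p q, CyclicSplit H t x p q → DiamLeThree (isolate H {x}) := fun x p q hs =>
    ih _ (card_edgeSet_lt (isolate_le H {x}) hs.adj_left fun h => h.2.1 rfl) _ hs.multEq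
      (hs.essConnected hH) rfl
  rcases classification ht heq hD with hac | ⟨x, p, q, h⟩ | ⟨x, p, v, w, q, h⟩
  · intro a a' b b' ha hb
    obtain ⟨v, w, hvw, hv, hw⟩ := exists_double_star ht heq hac ha
    refine DiamLeThree.of_core hH (C := {v, w}) ?_ (c := v) (by simp) hvw ?_ a a' b b' ha hb
    · rintro c (rfl | rfl) z hz
      · by_cases hzw : z = w
        · simp [hzw]
        · exact Or.inr (hv z hz hzw)
      · by_cases hzv : z = v
        · simp [hzv]
        · exact Or.inr (hw z hz hzv)
    · rintro c (rfl | rfl) d (rfl | rfl) hcd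
      · exact absurd rfl hcd
      · exact hvw
      · exact hvw.symm
      · exact absurd rfl hcd
  · refine DiamLeThree.of_core hH h.mem_core (c := x) (by simp) h.adj_xp ?_
    have h1 := h.adj_xp
    have h2 := h.adj_pq
    have h3 := h.adj_xq
    rintro c (rfl | rfl | rfl) d (rfl | rfl | rfl) hcd <;>
      first | exact absurd rfl hcd | assumption | (apply Adj.symm; assumption)
  · intro a a' b b' ha hb
    have hb' := h.mem_of_adj hH hb
    have h1 := h.toIsPentagon
    rcases h.mem_of_adj hH ha with rfl | rfl | rfl | rfl | rfl
    · exact h1.exists_walk hb'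
    · exact h1.rotate.exists_walk (by tauto)
    · exact h1.rotate.rotate.exists_walk (by tauto)
    · exact h1.rotate.rotate.rotate.exists_walk (by tauto)
    · exact h1.rotate.rotate.rotate.rotate.exists_walk (by tauto)

/-- The graphs that attain equality and are connected up to isolated vertices. -/
theorem classification_of_essConnected (ht : t ≠ 0) (heq : MultEq H t) (hH : EssConnected H) :
    (∀ x, ¬ IsCyclicVertex H x) ∨ (∃ x p q, IsTriangleCore H t x p q) ∨
      ∃ x p v w q, IsPentagonComponent H x p v w q :=
  classification ht heq fun _ _ _ hs => diamLeThree ht _ hs.multEq (hs.essConnected hH)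

end Classification

/-! ### Trees -/

section Trees

theorem isAcyclic_of_forall_not_isCyclicVertex {H : SimpleGraph V}
    (hac : ∀ x, ¬ IsCyclicVertex H x) : H.IsAcyclic := by
  rw [isAcyclic_iff_forall_adj_isBridge]
  intro x q hxq
  rw [isBridge_iff]
  intro hr
  obtain ⟨w, hw⟩ := hr.exists_isPath
  cases w with
  | nil => exact hxq.ne rfl
  | @cons _ p _ hxp w =>
    have hxp' : H.Adj x p ∧ p ≠ q := by
      refine ⟨hxp.1, ?_⟩
      rintro rfl
      exact hxp.2 (by simp [hxq.ne])
    refine hac x ⟨p, q, hxp'.2, hxp'.1, hxq, ?_⟩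
    have := reachable_isolate_of_walk w ((Walk.cons_isPath_iff _ _).1 hw).2 w.end_mem_support
    exact this.mono (isolate_mono (deleteEdges_le _) _)

theorem essConnected_of_connected {H : SimpleGraph V} (hH : H.Connected) : EssConnected H :=
  fun a _ b _ _ _ => hH.preconnected a b

theorem exists_adj_of_connected {H : SimpleGraph V} (hH : H.Connected) {a b : V} (hab : H.Adj a b)
    (c : V) : ∃ d, H.Adj c d := by
  by_cases hca : c = a
  · exact ⟨b, hca ▸ hab⟩
  · exact exists_adj_of_reachable_ne (hH.preconnected c a) hca

theorem diam_of_diamLeThree [Finite V] {H : SimpleGraph V} (hH : H.Connected)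
    (hD : DiamLeThree H) {a b : V} (hab : H.Adj a b) :
    H.diam = 1 ∨ H.diam = 2 ∨ H.diam = 3 := by
  have : Nontrivial V := ⟨a, b, hab.ne⟩
  have h0 := connected_iff_diam_ne_zero.1 hH
  have : Nonempty V := ⟨a⟩
  obtain ⟨u, v, huv⟩ := H.exists_dist_eq_diam
  obtain ⟨u', hu'⟩ := exists_adj_of_connected hH hab u
  obtain ⟨v', hv'⟩ := exists_adj_of_connected hH hab v
  obtain ⟨w, hw⟩ := hD u u' v v' hu' hv'
  have := dist_le w
  omega

/-- A path from an end of the edge `ab` can be shortened to a path that starts at one end of `ab`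
and avoids the other. -/
theorem exists_isPath_avoiding {H : SimpleGraph V} {a b c : V} (hab : a ≠ b) (p : H.Walk a c)
    (hp : p.IsPath) :
    (b ∉ p.support) ∨ ∃ q : H.Walk b c, q.IsPath ∧ a ∉ q.support ∧ q.support ⊆ p.support := by
  classical
  by_cases hb : b ∈ p.support
  · right
    cases p with
    | nil =>
      rw [Walk.support_nil, List.mem_singleton] at hb
      exact absurd hb.symm hab
    | @cons _ d _ had p =>
      rw [Walk.support_cons, List.mem_cons] at hb
      have hb' := hb.resolve_left hab.symm
      have hp' := (Walk.cons_isPath_iff _ _).1 hp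
      refine ⟨p.dropUntil b hb', hp'.1.dropUntil hb',
        fun h => hp'.2 (p.support_dropUntil_subset_support hb' h), fun s hs => ?_⟩
      rw [Walk.support_cons]
      exact List.mem_cons_of_mem _ (p.support_dropUntil_subset_support hb' hs)
  · exact Or.inl hb

/-- In a tree, the far ends of two edges at distance at least two have distance at least four. -/
theorem inducedMatchingNumber_le_one_of_isTree [Finite V] {H : SimpleGraph V} (hH : H.IsTree)
    (hdiam : H.diam ≤ 3) : inducedMatchingNumber H ≤ 1 := by
  have htop : H.ediam ≠ ⊤ := by
    have := hH.connected.nonempty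
    exact connected_iff_ediam_ne_top.1 hH.connected
  have hfar : ∀ {u u' v v' : V}, H.Adj u' u → H.Adj v' v → u ≠ v → ¬ H.Adj u v → u' ≠ v' →
      ∀ q : H.Walk u v, q.IsPath → u' ∉ q.support → v' ∉ q.support → False := by
    intro u u' v v' hu hv huv hadj hne q hq hu' hv'
    have h2 : 2 ≤ q.length := by
      cases q with
      | nil => exact absurd rfl huv
      | @cons _ _ _ h q =>
        cases q with
        | nil => exact absurd h hadj
        | cons _ _ => simp
    let r : H.Walk v' u := Walk.cons hv q.reverse
    have hr : r.IsPath := hq.reverse.cons (by simpa using hv')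
    let s : H.Walk u' v' := Walk.cons hu r.reverse
    have hs : s.IsPath := hr.reverse.cons (by
      rw [Walk.support_reverse, List.mem_reverse, Walk.support_cons, List.mem_cons,
        Walk.support_reverse, List.mem_reverse, not_or]
      exact ⟨hne, hu'⟩)
    have hlen : s.length = q.length + 2 := by simp [s, r]
    obtain ⟨k, hk⟩ := hH.connected.exists_walk_length_eq_dist u' v'
    have hkp := k.isPath_of_length_eq_dist hk
    have hsk : s = k := congrArg Subtype.val
      ((hH.isAcyclic.subsingleton_path u' v').elim ⟨s, hs⟩ ⟨k, hkp⟩)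
    have := H.dist_le_diam htop (u := u') (v := v')
    rw [← hk, ← hsk] at this
    omega
  refine inducedMatchingNumber_le_one fun a b c d hab hcd hac had hbc hbd => ?_
  by_contra! hno
  obtain ⟨hac', had', hbc', hbd'⟩ := hno
  -- It remains to shorten the path at its second end.
  have hhalf : ∀ {u u' : V}, H.Adj u' u → u ≠ c → u ≠ d → u' ≠ c → u' ≠ d → ¬ H.Adj u c →
      ¬ H.Adj u d → ∀ q : H.Walk u c, q.IsPath → u' ∉ q.support → False := by
    intro u u' hu huc hud huc' hud' hac had q hq hu'
    rcases exists_isPath_avoiding hcd.ne q.reverse hq.reverse with h | ⟨r, hr, hcr, hsub⟩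
    · exact hfar hu hcd.symm huc hac hud' q hq hu' (by simpa using h)
    · refine hfar hu hcd hud had huc' r.reverse hr.reverse ?_ (by simpa using hcr)
      intro h
      rw [Walk.support_reverse, List.mem_reverse] at h
      have := hsub h
      rw [Walk.support_reverse, List.mem_reverse] at this
      exact hu' this
  obtain ⟨p, hp⟩ := (hH.connected.preconnected a c).exists_isPath
  rcases exists_isPath_avoiding hab.ne p hp with h | ⟨q, hq, haq, -⟩
  · exact hhalf hab.symm hac had hbc hbd hac' had' p hp h
  · exact hhalf hab hbc hbd hac had hbc' hbd' q hq haq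

theorem cyclomaticNumber_of_isTree [Finite V] {H : SimpleGraph V} (hH : H.IsTree) :
    cyclomaticNumber H = 0 := by
  classical
  have := Fintype.ofFinite V
  have h1 := hH.card_edgeFinset
  rw [edgeFinset_card, ← Nat.card_eq_fintype_card, ← Nat.card_eq_fintype_card] at h1
  have := hH.connected.preconnected.subsingleton_connectedComponent
  have hne := hH.connected.nonempty
  have : Nonempty H.ConnectedComponent := ⟨H.connectedComponentMk hne.some⟩
  have h2 : Nat.card H.ConnectedComponent = 1 := Nat.card_unique
  unfold cyclomaticNumber
  omega

theorem multEq_of_isTree [Fintype V] {H : SimpleGraph V} {t : ℝ} (ht : t ≠ 0) (hH : H.IsTree)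
    (hdiam : H.diam ≤ 3) (hE : eigSpace H t ≠ ⊥) : MultEq H t := by
  have h1 := (multLe_and_fullSupport ht H).1
  have h2 := inducedMatchingNumber_le_one_of_isTree hH hdiam
  have h3 := cyclomaticNumber_of_isTree hH
  have h4 : 1 ≤ Module.finrank ℝ (eigSpace H t) := Submodule.one_le_finrank_iff.2 hE
  unfold MultLe MultEq at *
  omega

/-- A real symmetric matrix all of whose eigenvalues are zero is zero. -/
theorem exists_eigSpace_ne_bot [Fintype V] {H : SimpleGraph V} {a b : V} (hab : H.Adj a b) :
    ∃ t : ℝ, t ≠ 0 ∧ eigSpace H t ≠ ⊥ := by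
  classical
  have hA : (H.adjMatrix ℝ).IsHermitian := H.isHermitian_adjMatrix ℝ
  have hne : hA.eigenvalues ≠ 0 := by
    rw [Ne, hA.eigenvalues_eq_zero_iff]
    intro h0
    have := congrFun (congrFun h0 a) b
    simp [adjMatrix_apply, hab] at this
  obtain ⟨j, hj⟩ := Function.ne_iff.1 hne
  refine ⟨hA.eigenvalues j, hj, ?_⟩
  rw [← eigenspace_eq_eigSpace, Submodule.ne_bot_iff]
  refine ⟨(hA.eigenvectorBasis j).ofLp, ?_, ?_⟩
  · rw [Module.End.mem_eigenspace_iff, Matrix.toLin'_apply]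
    exact hA.mulVec_eigenvectorBasis j
  · intro h0
    have h1 := hA.eigenvectorBasis.orthonormal.ne_zero j
    apply h1
    ext i
    exact congrFun h0 i

end Trees

/-! ### The two exceptional families -/

section Exceptional

theorem triangleWithPendants_adj_inl_inl {a : ℕ} {i j : Fin 3} :
    (triangleWithPendants a).Adj (.inl i) (.inl j) ↔ i ≠ j := Iff.rfl

theorem triangleWithPendants_adj_inl_inr {a : ℕ} {i : Fin 3} {p : Fin 3 × Fin a} :
    (triangleWithPendants a).Adj (.inl i) (.inr p) ↔ i = p.1 := Iff.rfl

theorem triangleWithPendants_adj_inr_inl {a : ℕ} {i : Fin 3} {p : Fin 3 × Fin a} :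
    (triangleWithPendants a).Adj (.inr p) (.inl i) ↔ i = p.1 := Iff.rfl

theorem triangleWithPendants_adj_inr_inr {a : ℕ} {p q : Fin 3 × Fin a} :
    ¬ (triangleWithPendants a).Adj (.inr p) (.inr q) := id

theorem nonempty_iso_triangleWithPendants [Finite V] {H : SimpleGraph V} (hH : H.Connected) {a : ℕ}
    (core : Fin 3 → V) (hadj : ∀ i j, i ≠ j → H.Adj (core i) (core j))
    (hpend : ∀ i z, H.Adj (core i) z → (∃ j, z = core j) ∨ OnlyNeighbor H z (core i))
    (hcard : ∀ i, {z | H.Adj (core i) z ∧ ∀ j, z ≠ core j}.ncard = a) :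
    Nonempty (H ≃g triangleWithPendants a) := by
  classical
  have hinj : Function.Injective core := by
    intro i j hij
    by_contra h
    exact (hadj i j h).ne hij
  have e : ∀ i, Fin a ≃ {z | H.Adj (core i) z ∧ ∀ j, z ≠ core j} := fun i =>
    (Finite.equivFinOfCardEq (by rw [Nat.card_coe_set_eq]; exact hcard i)).symm
  let F : Fin 3 ⊕ Fin 3 × Fin a → V := Sum.elim core fun p => (e p.1 p.2 : V)
  have hF1 : ∀ i, F (.inl i) = core i := fun i => rfl
  have hF2 : ∀ p, H.Adj (core p.1) (F (.inr p)) ∧ ∀ j, F (.inr p) ≠ core j :=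
    fun p => (e p.1 p.2).2
  have hF3 : ∀ p, OnlyNeighbor H (F (.inr p)) (core p.1) := fun p =>
    (hpend p.1 _ (hF2 p).1).resolve_left fun ⟨j, hj⟩ => (hF2 p).2 j hj
  have hFinj : Function.Injective F := by
    rintro (i | p) (j | q) h
    · exact congrArg _ (hinj h)
    · exact absurd h.symm ((hF2 q).2 i)
    · exact absurd h ((hF2 p).2 j)
    · have h1 : p.1 = q.1 := by
        refine hinj (hF3 q _ ?_)
        rw [← h]
        exact (hF2 p).1.symm
      obtain ⟨p1, p2⟩ := p
      obtain ⟨q1, q2⟩ := q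
      obtain rfl : p1 = q1 := h1
      have : e p1 p2 = e p1 q2 := Subtype.ext h
      rw [(e p1).injective this]
  have hFsurj : Function.Surjective F := by
    intro z
    obtain ⟨z', hz'⟩ := exists_adj_of_connected hH (hadj 0 1 (by decide)) z
    have := (essConnected_of_connected hH).mem_or_pendant (C := Set.range core)
      (by
        rintro _ ⟨i, rfl⟩ z hz
        exact (hpend i z hz).imp (fun ⟨j, hj⟩ => ⟨j, hj.symm⟩) id)
      ⟨0, rfl⟩ (hadj 0 1 (by decide)) hz'
    by_cases hz : z ∈ Set.range core
    · obtain ⟨i, rfl⟩ := hz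
      exact ⟨.inl i, rfl⟩
    · obtain ⟨_, ⟨i, rfl⟩, hiz, -⟩ := this.resolve_left hz
      refine ⟨.inr (i, (e i).symm ⟨z, hiz, fun j hj => hz ⟨j, hj.symm⟩⟩), ?_⟩
      simp [F]
  refine ⟨(RelIso.symm ⟨Equiv.ofBijective F ⟨hFinj, hFsurj⟩, ?_⟩)⟩
  rintro (i | p) (j | q)
  · change H.Adj (core i) (core j) ↔ i ≠ j
    refine ⟨?_, hadj i j⟩
    rintro h rfl
    exact H.loopless.irrefl _ h
  · change H.Adj (core i) (F (.inr q)) ↔ i = q.1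
    refine ⟨fun h => hinj (hF3 q _ h.symm), ?_⟩
    rintro rfl
    exact (hF2 q).1
  · change H.Adj (F (.inr p)) (core j) ↔ j = p.1
    refine ⟨fun h => hinj (hF3 p _ h), ?_⟩
    rintro rfl
    exact (hF2 p).1.symm
  · change H.Adj (F (.inr p)) (F (.inr q)) ↔ False
    rw [iff_false]
    intro h
    exact (hF2 q).2 _ (hF3 p _ h)

theorem IsTriangleCore.exists_iso [Finite V] {H : SimpleGraph V} (hH : H.Connected) {t : ℝ}
    {x p q : V} (h : IsTriangleCore H t x p q) :
    ∃ a : ℕ, Nonempty (H ≃g triangleWithPendants a) ∧ t * t + t = a := by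
  have hset : ∀ {c b d : V},
      (∀ z, (∀ j : Fin 3, z ≠ (![x, p, q] : Fin 3 → V) j) ↔ z ≠ c ∧ z ≠ b ∧ z ≠ d) →
      {z | H.Adj c z ∧ ∀ j, z ≠ (![x, p, q] : Fin 3 → V) j} = {z | H.Adj c z ∧ z ≠ b ∧ z ≠ d} := by
    intro c b d hz
    ext z
    simp only [Set.mem_ofPred_eq, hz]
    exact ⟨fun h => ⟨h.1, h.2.2⟩, fun h => ⟨h.1, h.1.ne', h.2⟩⟩
  have hall : ∀ z, (∀ j : Fin 3, z ≠ (![x, p, q] : Fin 3 → V) j) ↔ z ≠ x ∧ z ≠ p ∧ z ≠ q := by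
    intro z
    simp [Fin.forall_fin_succ]
  refine ⟨_, nonempty_iso_triangleWithPendants hH
    (a := {z | H.Adj x z ∧ z ≠ p ∧ z ≠ q}.ncard) ![x, p, q] ?_ ?_ ?_, h.card_x.symm⟩
  · have h1 := h.adj_xp
    have h2 := h.adj_pq
    have h3 := h.adj_xq
    intro i j hij
    fin_cases i <;> fin_cases j <;>
      first | exact absurd rfl hij | assumption | (apply Adj.symm; assumption)
  · intro i z hz
    fin_cases i
    · rcases h.pendant_x z hz with h' | h' | h'
      · exact Or.inl ⟨1, h'⟩
      · exact Or.inl ⟨2, h'⟩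
      · exact Or.inr h'
    · rcases h.pendant_p z hz with h' | h' | h'
      · exact Or.inl ⟨0, h'⟩
      · exact Or.inl ⟨2, h'⟩
      · exact Or.inr h'
    · rcases h.pendant_q z hz with h' | h' | h'
      · exact Or.inl ⟨0, h'⟩
      · exact Or.inl ⟨1, h'⟩
      · exact Or.inr h'
  · intro i
    fin_cases i
    · exact congrArg Set.ncard (hset hall)
    · refine (congrArg Set.ncard (hset (c := p) (b := x) (d := q)
        fun z => (hall z).trans (by tauto))).trans ?_
      exact_mod_cast h.card_p.trans h.card_x.symm
    · refine (congrArg Set.ncard (hset (c := q) (b := x) (d := p)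
        fun z => (hall z).trans (by tauto))).trans ?_
      exact_mod_cast h.card_q.trans h.card_x.symm

theorem IsPentagonComponent.nonempty_iso {H : SimpleGraph V} (hH : H.Connected) {x p v w q : V}
    (h : IsPentagonComponent H x p v w q) : Nonempty (H ≃g cycleGraph 5) := by
  let F : Fin 5 → V := ![x, p, v, w, q]
  have a1 := h.adj_xp
  have a2 := h.adj_pv
  have a3 := h.adj_vw
  have a4 := h.adj_wq
  have a5 := h.adj_qx
  have n1 : ¬ H.Adj x v := fun h' => (h.nbr_x v h').elim h.adj_pv.ne' h.ne_vq
  have n2 : ¬ H.Adj p w := fun h' => (h.nbr_p w h').elim h.ne_wx h.adj_vw.ne'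
  have n3 : ¬ H.Adj v q := fun h' => (h.nbr_v q h').elim h.ne_qp h.adj_wq.ne'
  have n4 : ¬ H.Adj w x := fun h' => (h.nbr_w x h').elim h.ne_xv h.adj_qx.ne'
  have n5 : ¬ H.Adj q p := fun h' => (h.nbr_q p h').elim h.ne_pw h.adj_xp.ne'
  have hFadj : ∀ i j, H.Adj (F i) (F j) ↔ (cycleGraph 5).Adj i j := by
    intro i j
    rw [cycleGraph_adj']
    fin_cases i <;> fin_cases j <;>
      simp [F, a1, a2, a3, a4, a5, n1, n2, n3, n4, n5, a1.symm, a2.symm, a3.symm, a4.symm, a5.symm,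
        mt Adj.symm n1, mt Adj.symm n2, mt Adj.symm n3, mt Adj.symm n4, mt Adj.symm n5] <;> decide
  have hFinj : Function.Injective F := by
    have m1 := h.ne_xv
    have m2 := h.ne_pw
    have m3 := h.ne_vq
    have m4 := h.ne_wx
    have m5 := h.ne_qp
    intro i j hij
    fin_cases i <;> fin_cases j <;>
      simp [F, a1.ne, a2.ne, a3.ne, a4.ne, a5.ne, a1.ne', a2.ne', a3.ne', a4.ne', a5.ne', m1, m2,
        m3, m4, m5, m1.symm, m2.symm, m3.symm, m4.symm, m5.symm] at hij ⊢
  have hFsurj : Function.Surjective F := by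
    intro z
    obtain ⟨z', hz'⟩ := exists_adj_of_connected hH a1 z
    rcases h.mem_of_adj (essConnected_of_connected hH) hz' with rfl | rfl | rfl | rfl | rfl
    · exact ⟨0, rfl⟩
    · exact ⟨1, rfl⟩
    · exact ⟨2, rfl⟩
    · exact ⟨3, rfl⟩
    · exact ⟨4, rfl⟩
  exact ⟨RelIso.symm ⟨Equiv.ofBijective F ⟨hFinj, hFsurj⟩, fun {i j} => hFadj i j⟩⟩

end Exceptional

/-! ### Equality for the exceptional graphs -/

section Converse

variable {W : Type*}

theorem comp_iso_mem_eigSpace [Fintype V] [Fintype W] {H : SimpleGraph V} {K : SimpleGraph W}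
    (φ : H ≃g K) {t : ℝ} {y : W → ℝ} (hy : y ∈ eigSpace K t) : y ∘ φ ∈ eigSpace H t := by
  classical
  rw [mem_eigSpace]
  intro v
  rw [Function.comp_apply, ← mem_eigSpace.1 hy (φ v), ← Equiv.sum_comp φ.toEquiv]
  refine Finset.sum_congr rfl fun w _ => ?_
  have : K.Adj (φ v) (φ.toEquiv w) ↔ H.Adj v w := φ.map_adj_iff
  simp only [this]
  rfl

theorem inducedMatchingNumber_le_one_of_iso [Finite V] {H : SimpleGraph V} {K : SimpleGraph W}
    (φ : H ≃g K) (h : ∀ a b c d, K.Adj a b → K.Adj c d → a ≠ c → a ≠ d → b ≠ c → b ≠ d →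
      K.Adj a c ∨ K.Adj a d ∨ K.Adj b c ∨ K.Adj b d) : inducedMatchingNumber H ≤ 1 := by
  refine inducedMatchingNumber_le_one fun a b c d hab hcd h1 h2 h3 h4 => ?_
  have := h (φ a) (φ b) (φ c) (φ d) (φ.map_adj_iff.2 hab) (φ.map_adj_iff.2 hcd)
    (φ.injective.ne h1) (φ.injective.ne h2) (φ.injective.ne h3) (φ.injective.ne h4)
  simpa only [φ.map_adj_iff] using this

/-- A connected graph whose edges can be listed by its vertices has cyclomatic number at most one. -/
theorem cyclomaticNumber_le_one_of_iso [Finite V] [Finite W] {H : SimpleGraph V}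
    {K : SimpleGraph W} (hH : H.Connected) (φ : H ≃g K) (f : W → Sym2 W)
    (hf : ∀ a b, K.Adj a b → s(a, b) ∈ Set.range f) : cyclomaticNumber H ≤ 1 := by
  have h1 : Nat.card H.edgeSet = Nat.card K.edgeSet := Nat.card_congr φ.mapEdgeSet
  have h2 : Nat.card V = Nat.card W := Nat.card_congr φ.toEquiv
  have h3 : Nat.card K.edgeSet ≤ Nat.card W := by
    refine le_trans ?_ (Finite.card_range_le f)
    rw [Nat.card_coe_set_eq, Nat.card_coe_set_eq]
    refine Set.ncard_le_ncard (fun e he => ?_) (Set.toFinite _)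
    induction e using Sym2.ind with | _ a b
    exact hf a b he
  have := hH.preconnected.subsingleton_connectedComponent
  have hne := hH.nonempty
  have : Nonempty H.ConnectedComponent := ⟨H.connectedComponentMk hne.some⟩
  have h4 : Nat.card H.ConnectedComponent = 1 := Nat.card_unique
  unfold cyclomaticNumber
  omega

theorem two_le_finrank {E : Submodule ℝ (V → ℝ)} [Finite V] {y z : V → ℝ} (hy : y ∈ E) (hz : z ∈ E)
    {a b : V} (hya : y a ≠ 0) (hyb : y b = 0) (hzb : z b ≠ 0) : 2 ≤ Module.finrank ℝ E := by
  have hli : LinearIndependent ℝ ![(⟨y, hy⟩ : E), ⟨z, hz⟩] := by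
    rw [LinearIndependent.pair_iff]
    intro r s hrs
    have h : r • y + s • z = 0 := congrArg Subtype.val hrs
    have hb := congrFun h b
    have ha := congrFun h a
    simp only [Pi.add_apply, Pi.smul_apply, smul_eq_mul, Pi.zero_apply, hyb, mul_zero,
      zero_add] at hb
    have hs : s = 0 := (mul_eq_zero.1 hb).resolve_right hzb
    simp only [Pi.add_apply, Pi.smul_apply, smul_eq_mul, Pi.zero_apply, hs, zero_mul,
      add_zero] at ha
    exact ⟨(mul_eq_zero.1 ha).resolve_right hya, hs⟩
  simpa using hli.fintype_card_le_finrank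

theorem multEq_of_two_le [Fintype V] {H : SimpleGraph V} {t : ℝ} (ht : t ≠ 0)
    (h1 : inducedMatchingNumber H ≤ 1) (h2 : cyclomaticNumber H ≤ 1)
    (h3 : 2 ≤ Module.finrank ℝ (eigSpace H t)) : MultEq H t := by
  have h4 := (multLe_and_fullSupport ht H).1
  unfold MultLe MultEq at *
  omega

/-- A vector `u` on the triangle with sum zero extends to an eigenvector of `C₃(a,a,a)`. -/
theorem mem_eigSpace_triangleWithPendants {a : ℕ} {t : ℝ} (hta : t * t + t = a) {u : Fin 3 → ℝ}
    (hu : ∑ i, u i = 0) :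
    (Sum.elim (fun i => t * u i) (fun p => u p.1) : Fin 3 ⊕ Fin 3 × Fin a → ℝ) ∈
      eigSpace (triangleWithPendants a) t := by
  classical
  rw [mem_eigSpace]
  rintro (i | p)
  · rw [Fintype.sum_sum_type, Fintype.sum_prod_type]
    simp only [triangleWithPendants_adj_inl_inl, triangleWithPendants_adj_inl_inr, Sum.elim_inl,
      Sum.elim_inr, Finset.sum_const, Finset.card_univ, Fintype.card_fin, nsmul_eq_mul]
    have h1 : ∀ j, (if i ≠ j then t * u j else 0) = t * u j - if i = j then t * u j else 0 := by
      intro j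
      by_cases h : i = j <;> simp [h]
    have h2 : ∀ j, (a : ℝ) * (if i = j then u j else 0) = if i = j then a * u j else 0 := by
      intro j
      by_cases h : i = j <;> simp [h]
    rw [Finset.sum_congr rfl fun j _ => h1 j, Finset.sum_congr rfl fun j _ => h2 j,
      Finset.sum_sub_distrib, ← Finset.mul_sum, hu]
    simp only [Finset.sum_ite_eq, Finset.mem_univ, if_true]
    rw [← hta]
    ring
  · rw [Fintype.sum_sum_type]
    simp only [triangleWithPendants_adj_inr_inl, triangleWithPendants_adj_inr_inr, Sum.elim_inl,
      Sum.elim_inr, if_false, Finset.sum_const_zero, add_zero]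
    simp

theorem multEq_of_iso_triangleWithPendants [Fintype V] {H : SimpleGraph V} (hH : H.Connected)
    {a : ℕ} (φ : H ≃g triangleWithPendants a) {t : ℝ} (ht : t ≠ 0) (hta : t * t + t = a) :
    MultEq H t ∧ eigSpace H t ≠ ⊥ := by
  have h3 : 2 ≤ Module.finrank ℝ (eigSpace H t) := by
    refine two_le_finrank (a := φ.symm (.inl 1)) (b := φ.symm (.inl 2))
      (comp_iso_mem_eigSpace φ (mem_eigSpace_triangleWithPendants hta (u := ![1, -1, 0]) ?_))
      (comp_iso_mem_eigSpace φ (mem_eigSpace_triangleWithPendants hta (u := ![1, 0, -1]) ?_))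
      ?_ ?_ ?_
    · simp [Fin.sum_univ_three]
    · simp [Fin.sum_univ_three]
    · simpa using ht
    · simp
    · simpa using ht
  refine ⟨multEq_of_two_le ht ?_ ?_ h3, ?_⟩
  · -- Every edge has an end in the triangle.
    refine inducedMatchingNumber_le_one_of_iso φ ?_
    rintro (a | a) (b | b) (c | c) (d | d) hab hcd h1 h2 h3 h4 <;>
      simp_all [triangleWithPendants_adj_inl_inl, triangleWithPendants_adj_inr_inr]
  · refine cyclomaticNumber_le_one_of_iso hH φ
      (Sum.elim (fun i => s(.inl i, .inl (i + 1))) fun p => s(.inl p.1, .inr p)) ?_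
    rintro (i | p) (j | q) h
    · rw [triangleWithPendants_adj_inl_inl] at h
      have : j = i + 1 ∨ i = j + 1 := by
        revert i j
        decide
      rcases this with rfl | rfl
      · exact ⟨.inl i, rfl⟩
      · exact ⟨.inl j, Sym2.eq_swap⟩
    · rw [triangleWithPendants_adj_inl_inr] at h
      exact ⟨.inr q, by rw [h]; rfl⟩
    · rw [triangleWithPendants_adj_inr_inl] at h
      exact ⟨.inr p, by rw [h]; exact Sym2.eq_swap⟩
    · exact absurd h triangleWithPendants_adj_inr_inr
  · intro hbot
    rw [hbot, finrank_bot] at h3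
    omega

/-- Two consecutive values on `C₅` can be prescribed. -/
theorem mem_eigSpace_cycleGraph_five {t : ℝ} (ht : t * t + t = 1) (α β : ℝ) :
    (![α, β, t * β - α, -t * (α + β), t * α - β] : Fin 5 → ℝ) ∈ eigSpace (cycleGraph 5) t := by
  have ht2 : t * t = 1 - t := by linarith
  have hadj : ∀ i j : Fin 5, (cycleGraph 5).Adj i j ↔ j = i + 1 ∨ j = i + 4 := by
    simp only [cycleGraph_adj']
    decide
  have hne : ∀ i : Fin 5, i + 1 ≠ i + 4 := by decide
  rw [mem_eigSpace]
  intro i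
  generalize hy : (![α, β, t * β - α, -t * (α + β), t * α - β] : Fin 5 → ℝ) = y
  refine (Finset.sum_congr rfl (g := fun j =>
    (if j = i + 1 then y j else 0) + (if j = i + 4 then y j else 0)) fun j _ => ?_).trans ?_
  · by_cases h1 : j = i + 1
    · simp [hadj, h1, hne]
    · simp [hadj, h1]
  · rw [Finset.sum_add_distrib, Finset.sum_ite_eq', Finset.sum_ite_eq', if_pos (Finset.mem_univ _),
      if_pos (Finset.mem_univ _), ← hy]
    fin_cases i
    · simp
    · simp
    · simp
      linear_combination (-β) * ht2
    · simp
      linear_combination (α + β) * ht2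
    · simp
      linear_combination (-α) * ht2

theorem multEq_of_iso_cycleGraph_five [Fintype V] {H : SimpleGraph V} (hH : H.Connected)
    (φ : H ≃g cycleGraph 5) {t : ℝ} (ht : t ≠ 0) (ht1 : t * t + t = 1) :
    MultEq H t ∧ eigSpace H t ≠ ⊥ := by
  have h3 : 2 ≤ Module.finrank ℝ (eigSpace H t) :=
    two_le_finrank (a := φ.symm 0) (b := φ.symm 1)
      (comp_iso_mem_eigSpace φ (mem_eigSpace_cycleGraph_five ht1 1 0))
      (comp_iso_mem_eigSpace φ (mem_eigSpace_cycleGraph_five ht1 0 1))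
      (by simp) (by simp) (by simp)
  refine ⟨multEq_of_two_le ht ?_ ?_ h3, ?_⟩
  · refine inducedMatchingNumber_le_one_of_iso φ ?_
    simp only [cycleGraph_adj']
    decide
  · refine cyclomaticNumber_le_one_of_iso hH φ (fun i => s(i, i + 1)) fun i j h => ?_
    have : j = i + 1 ∨ i = j + 1 := by
      rw [cycleGraph_adj'] at h
      revert i j
      decide
    rcases this with rfl | rfl
    · exact ⟨i, rfl⟩
    · exact ⟨j, Sym2.eq_swap⟩
  · intro hbot
    rw [hbot, finrank_bot] at h3
    omega

/-- The roots of `t² + t = a`. -/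
theorem mul_self_add_self_eq_iff {t a : ℝ} (ha : 0 ≤ 1 + 4 * a) :
    t * t + t = a ↔ t = (√(1 + 4 * a) - 1) / 2 ∨ t = -(√(1 + 4 * a) + 1) / 2 := by
  have hs := Real.mul_self_sqrt ha
  constructor
  · intro h
    have : (t - (√(1 + 4 * a) - 1) / 2) * (t - -(√(1 + 4 * a) + 1) / 2) = 0 := by
      linear_combination h - hs / 4
    rcases mul_eq_zero.1 this with h | h
    · exact Or.inl (by linarith)
    · exact Or.inr (by linarith)
  · rintro (rfl | rfl) <;> linear_combination hs / 4

end Converse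

end InducedMatchingBound

theorem theorem3p1 {V : Type*} [Fintype V] [DecidableEq V] (G : SimpleGraph V)
    [DecidableRel G.Adj] (hG : G.Connected) :
    (∀ t : ℝ, t ≠ 0 → Module.End.HasEigenvalue (Matrix.toLin' (G.adjMatrix ℝ)) t →
      (InducedMatchingBound.eigMult G t : ℤ) ≤
          InducedMatchingBound.inducedMatchingNumber G +
            InducedMatchingBound.cyclomaticNumber G ∧
      ((InducedMatchingBound.eigMult G t : ℤ) =
          InducedMatchingBound.inducedMatchingNumber G +
            InducedMatchingBound.cyclomaticNumber G ↔
        (∃ a : ℕ, Nonempty (G ≃g InducedMatchingBound.triangleWithPendants a) ∧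
          (t = (√(1 + 4 * (a : ℝ)) - 1) / 2 ∨ t = -(√(1 + 4 * (a : ℝ)) + 1) / 2)) ∨
        (Nonempty (G ≃g SimpleGraph.cycleGraph 5) ∧
          (t = (√5 - 1) / 2 ∨ t = -(√5 + 1) / 2)) ∨
        (G.IsTree ∧ (G.diam = 1 ∨ G.diam = 2 ∨ G.diam = 3)))) ∧
    ((∃ t : ℝ, t ≠ 0 ∧ Module.End.HasEigenvalue (Matrix.toLin' (G.adjMatrix ℝ)) t ∧
        (InducedMatchingBound.eigMult G t : ℤ) =
          InducedMatchingBound.inducedMatchingNumber G +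
            InducedMatchingBound.cyclomaticNumber G) ↔
      (∃ a : ℕ, Nonempty (G ≃g InducedMatchingBound.triangleWithPendants a)) ∨
      Nonempty (G ≃g SimpleGraph.cycleGraph 5) ∨
      (G.IsTree ∧ (G.diam = 1 ∨ G.diam = 2 ∨ G.diam = 3))) := by
  open InducedMatchingBound in
  have hroot : ∀ {t : ℝ} {a : ℕ}, t * t + t = a ↔
      t = (√(1 + 4 * (a : ℝ)) - 1) / 2 ∨ t = -(√(1 + 4 * (a : ℝ)) + 1) / 2 :=
    mul_self_add_self_eq_iff (by positivity)
  have hroot5 : ∀ {t : ℝ}, t * t + t = 1 ↔ t = (√5 - 1) / 2 ∨ t = -(√5 + 1) / 2 := by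
    intro t
    have := mul_self_add_self_eq_iff (t := t) (a := 1) (by norm_num)
    norm_num at this ⊢
    exact this
  have hmult : ∀ t, (eigMult G t : ℤ) = inducedMatchingNumber G + cyclomaticNumber G ↔
      MultEq G t := by
    intro t
    rw [eigMult_eq_finrank]
    rfl
  have heig : ∀ t, Module.End.HasEigenvalue (Matrix.toLin' (G.adjMatrix ℝ)) t ↔
      eigSpace G t ≠ ⊥ := by
    intro t
    rw [Module.End.hasEigenvalue_iff, eigenspace_eq_eigSpace]
  have hpart : ∀ t : ℝ, t ≠ 0 → eigSpace G t ≠ ⊥ → (MultEq G t ↔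
      (∃ a : ℕ, Nonempty (G ≃g triangleWithPendants a) ∧
          (t = (√(1 + 4 * (a : ℝ)) - 1) / 2 ∨ t = -(√(1 + 4 * (a : ℝ)) + 1) / 2)) ∨
        (Nonempty (G ≃g SimpleGraph.cycleGraph 5) ∧
          (t = (√5 - 1) / 2 ∨ t = -(√5 + 1) / 2)) ∨
        (G.IsTree ∧ (G.diam = 1 ∨ G.diam = 2 ∨ G.diam = 3))) := by
    intro t ht hE
    constructor
    · intro heq
      have hess := essConnected_of_connected hG
      obtain ⟨a, b, hab⟩ : ∃ a b, G.Adj a b := by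
        obtain ⟨y, hy, hy0⟩ := (Submodule.ne_bot_iff _).1 hE
        obtain ⟨v, hv⟩ := Function.ne_iff.1 hy0
        by_contra! hno
        exact hv (eigSpace_apply_eq_zero ht hy (hno v))
      rcases classification_of_essConnected ht heq hess with
        hac | ⟨x, p, q, h⟩ | ⟨x, p, v, w, q, h⟩
      · exact Or.inr (Or.inr ⟨⟨hG, isAcyclic_of_forall_not_isCyclicVertex hac⟩,
          diam_of_diamLeThree hG (diamLeThree ht G heq hess) hab⟩)
      · obtain ⟨a, hiso, hta⟩ := h.exists_iso hG
        exact Or.inl ⟨a, hiso, hroot.1 hta⟩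
      · exact Or.inr (Or.inl ⟨h.nonempty_iso hG, hroot5.1 (h.eigenvalue_eq ht heq)⟩)
    · rintro (⟨a, ⟨φ⟩, hta⟩ | ⟨⟨φ⟩, ht5⟩ | ⟨htree, hdiam⟩)
      · exact (multEq_of_iso_triangleWithPendants hG φ ht (hroot.2 hta)).1
      · exact (multEq_of_iso_cycleGraph_five hG φ ht (hroot5.2 ht5)).1
      · exact multEq_of_isTree ht htree (by omega) hE
  refine ⟨fun t ht hev => ⟨?_, (hmult t).trans (hpart t ht ((heig t).1 hev))⟩, ?_, ?_⟩
  · rw [eigMult_eq_finrank]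
    exact (multLe_and_fullSupport ht G).1
  · rintro ⟨t, ht, hev, heq⟩
    rcases (hpart t ht ((heig t).1 hev)).1 ((hmult t).1 heq) with ⟨a, h, -⟩ | ⟨h, -⟩ | h
    · exact Or.inl ⟨a, h⟩
    · exact Or.inr (Or.inl h)
    · exact Or.inr (Or.inr h)
  · rintro (⟨a, ⟨φ⟩⟩ | ⟨⟨φ⟩⟩ | ⟨htree, hdiam⟩)
    · -- The negative root is nonzero for every `a`, including `a = 0`.
      have ht : -(√(1 + 4 * (a : ℝ)) + 1) / 2 ≠ 0 := by
        have := Real.sqrt_nonneg (1 + 4 * (a : ℝ))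
        linarith
      obtain ⟨h1, h2⟩ := multEq_of_iso_triangleWithPendants hG φ ht (hroot.2 (Or.inr rfl))
      exact ⟨_, ht, (heig _).2 h2, (hmult _).2 h1⟩
    · have ht : -(√5 + 1) / 2 ≠ 0 := by
        have := Real.sqrt_nonneg 5
        linarith
      obtain ⟨h1, h2⟩ := multEq_of_iso_cycleGraph_five hG φ ht (hroot5.2 (Or.inr rfl))
      exact ⟨_, ht, (heig _).2 h2, (hmult _).2 h1⟩
    · have hnt := SimpleGraph.nontrivial_of_diam_ne_zero (G := G) (by omega)
      obtain ⟨a, b, hab⟩ := exists_pair_ne V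
      obtain ⟨c, hac⟩ := exists_adj_of_reachable_ne (hG.preconnected a b) hab
      obtain ⟨t, ht, hE⟩ := exists_eigSpace_ne_bot hac
      exact ⟨t, ht, (heig t).2 hE, (hmult t).2 (multEq_of_isTree ht htree (by omega) hE)⟩
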